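/- **Theorem (Weight Preservation).** Let $\mathsf S$ be a commutative ring. *Terms* are $t ::= x\mid\lambda x.t\mid (t)\,t\mid\alpha\cdot t\mid t+t$ with $\alpha\in\mathsf S$, taken up to renaming of bound variables and modulo associativity and commutativity of $+$; *basis terms* are $b ::= x\mid\lambda x.t$. Reduction $\to$ is generated by $1\cdot t\to t$; $\ \alpha\cdot(\beta\cdot t)\to(\alpha\beta)\cdot t$; $\ \alpha\cdot(t+r)\to\alpha\cdot t+\alpha\cdot r$; $\alpha\cdot t+\beta\cdot t\to(\alpha+\beta)\cdot t$; $\ \alpha\cdot t+t\to(\alpha+1)\cdot t$; $\ t+t\to(1+1)\cdot t$; $(t+r)\,u\to (t)\,u+(r)\,u$; $\ (t)\,(r+u)\to(t)\,r+(t)\,u$; $\ (\alpha\cdot t)\,r\to\alpha\cdot(t)\,r$; $\ (t)\,(\alpha\cdot r)\to\alpha\cdot(t)\,r$; $(\lambda x.t)\,b\to t[b/x]$ for $b$ a basis term, and is closed under all contexts; $\to^*$ is its reflexive transitive closure. A *value* is a term $\sum_{i=1}^{n}\alpha_i\cdot\lambda x_i.t_i+\sum_{j=n+1}^{m}\lambda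 x_j.t_j$ with at least one summand and $\lambda x_i.t_i\ne\lambda x_j.t_j$ for $i\le n<j$. *Types* are $T ::= U\mid\alpha\cdot T\mid T+T\mid\mathbb X$ and *unit types* $U ::= \mathcal X\mid U\to T\mid\forall\mathcal X.U\mid\forall\mathbb X.U$, up to renaming of bound variables; unit variables $\mathcal X$ are replaced by unit types only, general variables $\mathbb X$ by any type; $X$ stands for a variable of either sort, and $[A/X]$ for a substitution that respects sorts. Let $\equiv$ be the least congruence on types with $1\cdot T\equiv T$, $\alpha\cdot(\beta\cdot T)\equiv(\alpha\beta)\cdot T$, $\alpha\cdot T+\alpha\cdot R\equiv\alpha\cdot(T+R)$, $\alpha\cdot T+\beta\cdot T\equiv(\alpha+\beta)\cdot T$, $T+R\equiv R+T$, $T+(R+Q)\equiv(T+R)+Q$. The typing rules, in which $\Gamma$ assigns unit types to term variables and all sums are non-empty, are: - $\Gamma,x:U\vdash x:U$; if $\Gamma\vdash t:T$ and $R\equiv T$ then $\Gamma\vdash t:R$; - if $\Gamma,x:U\vdash t:T$ then $\Gamma\vdash\lambda x.t:U\to T$; - if $\Gamma\vdash t:\sum_i\alpha_i\cdot\forall\vec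 X.(U\to T_i)$ and $\Gamma\vdash r:\sum_j\beta_j\cdot U[\vec A_j/\vec X]$ then $\Gamma\vdash(t)\,r:\sum_i\sum_j\alpha_i\beta_j\cdot T_i[\vec A_j/\vec X]$; - if $\Gamma\vdash t:\sum_i\alpha_i\cdot U_i$ and $X$ is not free in $\Gamma$ then $\Gamma\vdash t:\sum_i\alpha_i\cdot\forall X.U_i$; if $\Gamma\vdash t:\sum_i\alpha_i\cdot\forall X.U_i$ then $\Gamma\vdash t:\sum_i\alpha_i\cdot U_i[A/X]$; - if $\Gamma\vdash t:T$ and $\Gamma\vdash r:R$ then $\Gamma\vdash t+r:T+R$; if $\Gamma\vdash 1\cdot t:T$ then $\Gamma\vdash t:T$; - if $\Gamma\vdash t:T_i$ for $i=1,\dots,n$ then $\Gamma\vdash(\sum_{i=1}^n\alpha_i)\cdot t:\sum_{i=1}^n\alpha_i\cdot T_i$. The *weight* $|\cdot|$ is the partial function to $\mathsf S$ given on types by $|U|=1$, $|\alpha\cdot T|=\alpha|T|$, $|T+R|=|T|+|R|$ (so $|\mathbb X|$ is undefined), and on terms by $|b|=1$, $|\alpha\cdot t|=\alpha|t|$, $|t+r|=|t|+|r|$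 (so $|(t)\,r|$ is undefined). If $\vdash t:T$ (in the empty context) and $t\to^* v$ with $v$ a value, then $|T|$ and $|v|$ are both defined, and $|T|=|v|$. -/

import Mathlib

namespace VecLambda

universe u

/-! ### Types -/

/-- The two sorts of type variables: `unit` variables are replaced by unit types only,
`gen` variables by arbitrary types. -/
inductive Kind
  | unit
  | gen

/-- Types over the scalars `S`: `Ty S .unit` are the unit types
`U ::= X | U → T | ∀X.U` (with `X` bound of either sort), and `Ty S .gen` the general types
`T ::= U | α·T | T + T | 𝕏`. Type variables are de Bruijn indices, with a separate numbering for
each of the two sorts; `all k` binds index `0` of sort `k`. -/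
inductive Ty (S : Type u) : Kind → Type u
  | var (k : Kind) (n : ℕ) : Ty S k
  | arr (U : Ty S .unit) (T : Ty S .gen) : Ty S .unit
  | all (k : Kind) (U : Ty S .unit) : Ty S .unit
  | ofUnit (U : Ty S .unit) : Ty S .gen
  | smul (a : S) (T : Ty S .gen) : Ty S .gen
  | add (T R : Ty S .gen) : Ty S .gen

/-- Renamings of type variables. -/
abbrev TyRen := Kind → ℕ → ℕ

/-- The renaming that makes room for one new variable of sort `k`. -/
def TyRen.shift : Kind → TyRen
  | .unit, .unit, n => n + 1
  | .unit, .gen, n => n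
  | .gen, .unit, n => n
  | .gen, .gen, n => n + 1

/-- A renaming carried under a binder of sort `k`. -/
def TyRen.lift (ρ : TyRen) : Kind → TyRen
  | .unit, .unit, 0 => 0
  | .unit, .unit, n + 1 => ρ .unit n + 1
  | .unit, .gen, n => ρ .gen n
  | .gen, .unit, n => ρ .unit n
  | .gen, .gen, 0 => 0
  | .gen, .gen, n + 1 => ρ .gen n + 1

def Ty.rename {S : Type u} : {k : Kind} → TyRen → Ty S k → Ty S k
  | _, ρ, .var k n => .var k (ρ k n)
  | _, ρ, .arr U T => .arr (U.rename ρ) (T.rename ρ)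
  | _, ρ, .all k U => .all k (U.rename (ρ.lift k))
  | _, ρ, .ofUnit U => .ofUnit (U.rename ρ)
  | _, ρ, .smul a T => .smul a (T.rename ρ)
  | _, ρ, .add T R => .add (T.rename ρ) (R.rename ρ)

/-- Simultaneous substitutions: unit variables are sent to unit types, general variables to
general types. -/
abbrev TySub (S : Type u) := (k : Kind) → ℕ → Ty S k

/-- The substitution that extends `σ` by a new variable `0` of the sort of `A`, sent to `A`. -/
def TySub.push {S : Type u} : (Σ k, Ty S k) → TySub S → TySub S
  | ⟨.unit, A⟩, _, .unit, 0 => A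
  | ⟨.unit, _⟩, σ, .unit, n + 1 => σ .unit n
  | ⟨.unit, _⟩, σ, .gen, n => σ .gen n
  | ⟨.gen, _⟩, σ, .unit, n => σ .unit n
  | ⟨.gen, A⟩, _, .gen, 0 => A
  | ⟨.gen, _⟩, σ, .gen, n + 1 => σ .gen n

/-- A substitution carried under a binder of sort `k`. -/
def TySub.lift {S : Type u} (σ : TySub S) (k : Kind) : TySub S :=
  TySub.push ⟨k, .var k 0⟩ (fun k' n => (σ k' n).rename (TyRen.shift k))

def Ty.subst {S : Type u} : {k : Kind} → TySub S → Ty S k → Ty S k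
  | _, σ, .var k n => σ k n
  | _, σ, .arr U T => .arr (U.subst σ) (T.subst σ)
  | _, σ, .all k U => .all k (U.subst (σ.lift k))
  | _, σ, .ofUnit U => .ofUnit (U.subst σ)
  | _, σ, .smul a T => .smul a (T.subst σ)
  | _, σ, .add T R => .add (T.subst σ) (R.subst σ)

/-- `∀X₁.…∀Xₙ.U`, the outermost binder first in the list of sorts. -/
def Ty.allN {S : Type u} (ks : List Kind) (U : Ty S .unit) : Ty S .unit :=
  ks.foldr Ty.all U

/-- The simultaneous substitution `[A₁/X₁, …, Aₙ/Xₙ]` for variables bound by `∀X₁.…∀Xₙ`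
(`Xₙ`, bound innermost, is the last one pushed). -/
def TySub.ofList {S : Type u} (As : List (Σ k, Ty S k)) : TySub S :=
  As.foldl (fun σ A => TySub.push A σ) (fun k n => .var k n)

/-- The (non-empty) sum `f 0 + f 1 + … + f n`, bracketed to the left. -/
def Ty.sum {S : Type u} : {n : ℕ} → (Fin (n + 1) → Ty S .gen) → Ty S .gen
  | 0, f => f 0
  | _ + 1, f => .add (Ty.sum fun i => f i.castSucc) (f (Fin.last _))

/-- `∑ᵢ αᵢ·Tᵢ`. -/
def Ty.lin {S : Type u} {n : ℕ} (a : Fin (n + 1) → S) (T : Fin (n + 1) → Ty S .gen) :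
    Ty S .gen :=
  Ty.sum fun i => .smul (a i) (T i)

/-- Equivalence of types: the least congruence containing the weak module axioms. -/
inductive Ty.Equiv {S : Type u} [CommRing S] : Ty S .gen → Ty S .gen → Prop
  | one_smul (T : Ty S .gen) : Ty.Equiv (.smul 1 T) T
  | smul_smul (a b : S) (T : Ty S .gen) : Ty.Equiv (.smul a (.smul b T)) (.smul (a * b) T)
  | smul_add (a : S) (T R : Ty S .gen) :
      Ty.Equiv (.add (.smul a T) (.smul a R)) (.smul a (.add T R))
  | add_smul (a b : S) (T : Ty S .gen) :
      Ty.Equiv (.add (.smul a T) (.smul b T)) (.smul (a + b) T)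
  | add_comm (T R : Ty S .gen) : Ty.Equiv (.add T R) (.add R T)
  | add_assoc (T R Q : Ty S .gen) : Ty.Equiv (.add T (.add R Q)) (.add (.add T R) Q)
  | refl (T : Ty S .gen) : Ty.Equiv T T
  | symm {T R : Ty S .gen} : Ty.Equiv T R → Ty.Equiv R T
  | trans {T R Q : Ty S .gen} : Ty.Equiv T R → Ty.Equiv R Q → Ty.Equiv T Q
  | congr_smul (a : S) {T R : Ty S .gen} : Ty.Equiv T R → Ty.Equiv (.smul a T) (.smul a R)
  | congr_add {T T' R R' : Ty S .gen} :
      Ty.Equiv T T' → Ty.Equiv R R' → Ty.Equiv (.add T R) (.add T' R')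
  | congr_arr {U V : Ty S .unit} {T R : Ty S .gen} :
      Ty.Equiv (.ofUnit U) (.ofUnit V) → Ty.Equiv T R →
      Ty.Equiv (.ofUnit (.arr U T)) (.ofUnit (.arr V R))
  | congr_all (k : Kind) {U V : Ty S .unit} :
      Ty.Equiv (.ofUnit U) (.ofUnit V) → Ty.Equiv (.ofUnit (.all k U)) (.ofUnit (.all k V))

/-- The weight of a type, a partial function: a general variable has no weight, and neither has
a linear combination in which a general variable occurs as a summand. -/
def Ty.weight {S : Type u} [CommRing S] : {k : Kind} → Ty S k → Option S
  | _, .var .unit _ => some 1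
  | _, .var .gen _ => none
  | _, .arr _ _ => some 1
  | _, .all _ _ => some 1
  | _, .ofUnit _ => some 1
  | _, .smul a T => T.weight.map (a * ·)
  | _, .add T R => Option.map₂ (· + ·) T.weight R.weight

/-! ### Terms -/

/-- Terms (de Bruijn indices for the term variables). -/
inductive Term (S : Type u) : Type u
  | var (n : ℕ) : Term S
  | lam (t : Term S) : Term S
  | app (t r : Term S) : Term S
  | smul (a : S) (t : Term S) : Term S
  | add (t r : Term S) : Term S

def liftRen (ρ : ℕ → ℕ) : ℕ → ℕ
  | 0 => 0
  | n + 1 => ρ n + 1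

def Term.rename {S : Type u} : (ℕ → ℕ) → Term S → Term S
  | ρ, .var n => .var (ρ n)
  | ρ, .lam t => .lam (t.rename (liftRen ρ))
  | ρ, .app t r => .app (t.rename ρ) (r.rename ρ)
  | ρ, .smul a t => .smul a (t.rename ρ)
  | ρ, .add t r => .add (t.rename ρ) (r.rename ρ)

def liftSub {S : Type u} (σ : ℕ → Term S) : ℕ → Term S
  | 0 => .var 0
  | n + 1 => (σ n).rename Nat.succ

def Term.subst {S : Type u} : (ℕ → Term S) → Term S → Term S
  | σ, .var n => σ n
  | σ, .lam t => .lam (t.subst (liftSub σ))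
  | σ, .app t r => .app (t.subst σ) (r.subst σ)
  | σ, .smul a t => .smul a (t.subst σ)
  | σ, .add t r => .add (t.subst σ) (r.subst σ)

/-- `t[b/x]`, where `x` is the variable with index `0` in `t`. -/
def Term.inst {S : Type u} (t b : Term S) : Term S :=
  t.subst fun
    | 0 => b
    | n + 1 => .var n

/-- Basis terms: variables and abstractions. -/
inductive Term.IsBasis {S : Type u} : Term S → Prop
  | var (n : ℕ) : Term.IsBasis (.var n)
  | lam (t : Term S) : Term.IsBasis (.lam t)

/-- Equality of terms modulo associativity and commutativity of `+` (anywhere in a term). -/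
inductive Term.AC {S : Type u} : Term S → Term S → Prop
  | comm (t r : Term S) : Term.AC (.add t r) (.add r t)
  | assoc (t r s : Term S) : Term.AC (.add t (.add r s)) (.add (.add t r) s)
  | refl (t : Term S) : Term.AC t t
  | symm {t r : Term S} : Term.AC t r → Term.AC r t
  | trans {t r s : Term S} : Term.AC t r → Term.AC r s → Term.AC t s
  | lam {t r : Term S} : Term.AC t r → Term.AC (.lam t) (.lam r)
  | app {t t' r r' : Term S} : Term.AC t t' → Term.AC r r' → Term.AC (.app t r) (.app t' r')
  | smul (a : S) {t r : Term S} : Term.AC t r → Term.AC (.smul a t) (.smul a r)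
  | add {t t' r r' : Term S} : Term.AC t t' → Term.AC r r' → Term.AC (.add t r) (.add t' r')

/-- The rewrite rules and the contextual rules, on syntactic terms. -/
inductive Term.Red {S : Type u} [CommRing S] : Term S → Term S → Prop
  -- elementary rules
  | one_smul (t : Term S) : Term.Red (.smul 1 t) t
  | smul_smul (a b : S) (t : Term S) : Term.Red (.smul a (.smul b t)) (.smul (a * b) t)
  | smul_add (a : S) (t r : Term S) :
      Term.Red (.smul a (.add t r)) (.add (.smul a t) (.smul a r))
  -- factorisation rules
  | fact (a b : S) (t : Term S) :
      Term.Red (.add (.smul a t) (.smul b t)) (.smul (a + b) t)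
  | fact_one (a : S) (t : Term S) : Term.Red (.add (.smul a t) t) (.smul (a + 1) t)
  | fact_one_one (t : Term S) : Term.Red (.add t t) (.smul (1 + 1) t)
  -- application rules
  | add_app (t r s : Term S) : Term.Red (.app (.add t r) s) (.add (.app t s) (.app r s))
  | app_add (t r s : Term S) : Term.Red (.app t (.add r s)) (.add (.app t r) (.app t s))
  | smul_app (a : S) (t r : Term S) : Term.Red (.app (.smul a t) r) (.smul a (.app t r))
  | app_smul (a : S) (t r : Term S) : Term.Red (.app t (.smul a r)) (.smul a (.app t r))
  -- beta reduction
  | beta (t b : Term S) : b.IsBasis → Term.Red (.app (.lam t) b) (t.inst b)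
  -- contextual rules
  | ctx_smul (a : S) {t r : Term S} : Term.Red t r → Term.Red (.smul a t) (.smul a r)
  | ctx_add (s : Term S) {t r : Term S} : Term.Red t r → Term.Red (.add s t) (.add s r)
  | ctx_app_right (s : Term S) {t r : Term S} : Term.Red t r → Term.Red (.app s t) (.app s r)
  | ctx_app_left (s : Term S) {t r : Term S} : Term.Red t r → Term.Red (.app t s) (.app r s)
  | ctx_lam {t r : Term S} : Term.Red t r → Term.Red (.lam t) (.lam r)

/-- One reduction step `t → r`, modulo associativity and commutativity of `+`. -/
def Term.Step {S : Type u} [CommRing S] (t r : Term S) : Prop :=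
  ∃ t' r', Term.AC t t' ∧ Term.Red t' r' ∧ Term.AC r' r

/-- `t →* r`. -/
def Term.Reduces {S : Type u} [CommRing S] : Term S → Term S → Prop :=
  Relation.ReflTransGen Term.Step

/-- The values `∑_{i ≤ n} αᵢ·λxᵢ.tᵢ + ∑_{n < j ≤ m} λxⱼ.tⱼ` (with at least one summand), where
`λxᵢ.tᵢ ≠ λxⱼ.tⱼ` for all `i ≤ n < j ≤ m`; terms are read modulo associativity and
commutativity of `+`. -/
def Term.IsValue {S : Type u} (v : Term S) : Prop :=
  ∃ (L : List (S × Term S)) (M : List (Term S)) (s : Term S) (l : List (Term S)),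
    (∀ p ∈ L, ∀ q ∈ M, ¬ Term.AC (.lam p.2) (.lam q)) ∧
    L.map (fun p => Term.smul p.1 (.lam p.2)) ++ M.map Term.lam = s :: l ∧
    Term.AC v (l.foldl Term.add s)

/-- The weight of a term, a partial function: applications have no weight. -/
def Term.weight {S : Type u} [CommRing S] : Term S → Option S
  | .var _ => some 1
  | .lam _ => some 1
  | .app _ _ => none
  | .smul a t => t.weight.map (a * ·)
  | .add t r => Option.map₂ (· + ·) t.weight r.weight

/-! ### Typing -/

/-- The typing relation `Γ ⊢ t : T`. The context `Γ` lists the unit types of the term variables,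
index `0` first; in `all_intro` the variable `X ∉ FV(Γ)` is the new variable `0`. -/
inductive HasType {S : Type u} [CommRing S] :
    List (Ty S .unit) → Term S → Ty S .gen → Prop
  | ax {Γ : List (Ty S .unit)} {n : ℕ} {U : Ty S .unit} :
      Γ[n]? = some U → HasType Γ (.var n) (.ofUnit U)
  | equiv {Γ : List (Ty S .unit)} {t : Term S} {T R : Ty S .gen} :
      HasType Γ t T → Ty.Equiv R T → HasType Γ t R
  | arr_intro {Γ : List (Ty S .unit)} {t : Term S} {U : Ty S .unit} {T : Ty S .gen} :
      HasType (U :: Γ) t T → HasType Γ (.lam t) (.ofUnit (.arr U T))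
  | arr_elim {Γ : List (Ty S .unit)} {t r : Term S} {n m : ℕ} (ks : List Kind)
      (U : Ty S .unit) (a : Fin (n + 1) → S) (T : Fin (n + 1) → Ty S .gen)
      (b : Fin (m + 1) → S) (A : Fin (m + 1) → List (Σ k, Ty S k)) :
      (∀ j, (A j).map Sigma.fst = ks) →
      HasType Γ t (Ty.lin a fun i => .ofUnit (Ty.allN ks (.arr U (T i)))) →
      HasType Γ r (Ty.lin b fun j => .ofUnit (U.subst (TySub.ofList (A j)))) →
      HasType Γ (.app t r)
        (Ty.sum fun i => Ty.lin (fun j => a i * b j) fun j => (T i).subst (TySub.ofList (A j)))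
  | all_intro {Γ : List (Ty S .unit)} {t : Term S} {n : ℕ} (k : Kind)
      (a : Fin (n + 1) → S) (U : Fin (n + 1) → Ty S .unit) :
      HasType (Γ.map (Ty.rename (TyRen.shift k))) t (Ty.lin a fun i => .ofUnit (U i)) →
      HasType Γ t (Ty.lin a fun i => .ofUnit (.all k (U i)))
  | all_elim {Γ : List (Ty S .unit)} {t : Term S} {n : ℕ} (k : Kind) (A : Ty S k)
      (a : Fin (n + 1) → S) (U : Fin (n + 1) → Ty S .unit) :
      HasType Γ t (Ty.lin a fun i => .ofUnit (.all k (U i))) →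
      HasType Γ t (Ty.lin a fun i => .ofUnit ((U i).subst (TySub.ofList [⟨k, A⟩])))
  | add_intro {Γ : List (Ty S .unit)} {t r : Term S} {T R : Ty S .gen} :
      HasType Γ t T → HasType Γ r R → HasType Γ (.add t r) (.add T R)
  | one_elim {Γ : List (Ty S .unit)} {t : Term S} {T : Ty S .gen} :
      HasType Γ (.smul 1 t) T → HasType Γ t T
  | smul_intro {Γ : List (Ty S .unit)} {t : Term S} {n : ℕ}
      (a : Fin (n + 1) → S) (T : Fin (n + 1) → Ty S .gen) :
      (∀ i, HasType Γ t (T i)) → HasType Γ (.smul (∑ i, a i) t) (Ty.lin a T)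

end VecLambda

/-! A term may have several inequivalent types, and the rules for `(∑ αᵢ)·t` and `1·t` together
close the set of its types under affine combinations, those of total coefficient 1. Modulo `Equiv`,
types form a weak module `Cls S` (no zero vector), and the types of `t` form an affine subset
`typesOf Γ t` of it. Affine subsets are again a weak module, where `a • X` collects the combinations
of points of `X` with total coefficient `a`. In particular `(a + b) • X = a • X + b • X`, which is
what factorisation needs when the two copies of a term are typed differently.

By `HasType.typing` every derivation yields one in the system `Typing`, whose rules have this
closure built in. There `typesOf` is linear in the term (`typesOf_add`, `typesOf_smul`), so the
module rewriting rules become laws of affine sets. Applications are governed by `appTy`, the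
bilinear extension of instantiating one function type and matching its domain with one argument
type. This settles distributivity. For β, `Typing.canon` and `Typing.all_of_isBasis` reduce to a
single arrow and a single unit type; both sides have weight 1, so the resulting combination is
affine. Hence reduction preserves types (`Term.Reduces.typing`).

Weight is linear, so a combination with total coefficient `a` of types of weight `w` weighs `a * w`.
Consequently every type of a term with a weight has that same weight (`Typing.weight`). A value has
a weight, and the type of the original term is one of its types. -/

namespace VecLambda

/-! ### Weak modules and affine sets -/

/-- A weak module: a module without a zero vector. -/
class WeakModule (S G : Type*) [CommRing S] [AddCommSemigroup G] extends MulAction S G where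
  smul_add' (a : S) (x y : G) : a • (x + y) = a • x + a • y
  add_smul' (a b : S) (x : G) : (a + b) • x = a • x + b • x

namespace WeakModule

variable {S G : Type*} [CommRing S] [AddCommSemigroup G] [WeakModule S G]

/-- `Aff X w g`: `g` is a combination of elements of `X` with total coefficient `w`. -/
inductive Aff (X : Set G) : S → G → Prop
  | of {x : G} : x ∈ X → Aff X 1 x
  | smul (a : S) {w : S} {g : G} : Aff X w g → Aff X (a * w) (a • g)
  | add {w w' : S} {g g' : G} : Aff X w g → Aff X w' g' → Aff X (w + w') (g + g')

/-- Total coefficients multiply under nesting; this is what makes hulls and scalar multiples affine.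
-/
theorem Aff.bind {X Y : Set G} {b : S} (h : ∀ x ∈ X, Aff Y b x) {w : S} {g : G}
    (hg : Aff X w g) : Aff Y (w * b) g := by
  induction hg with
  | of hx => rw [one_mul]; exact h _ hx
  | smul a _ ih => rw [mul_assoc]; exact ih.smul a
  | add _ _ ih ih' => rw [add_mul]; exact ih.add ih'

theorem Aff.mono {X Y : Set G} (h : X ⊆ Y) {w : S} {g : G} (hg : Aff X w g) : Aff Y w g := by
  simpa using hg.bind (b := (1 : S)) fun x hx => .of (h hx)

theorem Aff.smul_of {X : Set G} (a : S) {x : G} (hx : x ∈ X) : Aff X a (a • x) := by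
  simpa using (Aff.of (S := S) hx).smul a

/-- Every combination absorbs the zero multiple of one of its points. -/
theorem Aff.exists_absorb {X : Set G} {w : S} {g : G} (hg : Aff X w g) :
    ∃ x ∈ X, g + (0 : S) • x = g := by
  induction hg with
  | @of x hx =>
    refine ⟨x, hx, ?_⟩
    nth_rewrite 1 [← one_smul S x]
    rw [← add_smul', add_zero, one_smul]
  | smul a _ ih =>
    obtain ⟨x, hx, e⟩ := ih
    refine ⟨x, hx, ?_⟩
    nth_rewrite 2 [← e]
    rw [smul_add', smul_smul, mul_zero]
  | add _ _ ih _ =>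
    obtain ⟨x, hx, e⟩ := ih
    refine ⟨x, hx, ?_⟩
    nth_rewrite 2 [← e]
    ac_rfl

theorem Aff.translate {X Z : Set G} (y : G) (h : ∀ x ∈ X, x + y ∈ Z) {w : S} {g : G}
    (hg : Aff X w g) : Aff Z w (g + w • y) := by
  induction hg with
  | of hx => rw [one_smul]; exact .of (h _ hx)
  | smul a _ ih => rw [mul_smul, ← smul_add']; exact ih.smul a
  | @add w w' g g' _ _ ih ih' =>
    have := ih.add ih'
    rw [add_smul']
    convert this using 1
    ac_rfl

theorem Aff.cast {X : Set G} {w w' : S} {g g' : G} (hg : Aff X w g) (hw : w = w') (e : g = g') :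
    Aff X w' g' := by
  subst hw e; exact hg

end WeakModule

open WeakModule

/-- Sets closed under affine combinations. -/
structure AffSet (S G : Type*) [CommRing S] [AddCommSemigroup G] [WeakModule S G] where
  carrier : Set G
  closed : ∀ {g : G}, Aff (S := S) carrier 1 g → g ∈ carrier

/-! ### The weak module of affine sets -/

namespace AffSet

variable {S G : Type*} [CommRing S] [AddCommSemigroup G] [WeakModule S G]

instance : Membership G (AffSet S G) := ⟨fun X g => g ∈ X.carrier⟩

@[ext]
theorem ext {X Y : AffSet S G} (h : ∀ g, g ∈ X ↔ g ∈ Y) : X = Y := by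
  cases X; cases Y; congr; exact Set.ext h

instance : LE (AffSet S G) := ⟨fun X Y => ∀ ⦃g⦄, g ∈ X → g ∈ Y⟩

variable (S) in
/-- The affine hull. -/
def span (X : Set G) : AffSet S G where
  carrier := {g | Aff X (1 : S) g}
  closed h := by simpa using h.bind (b := (1 : S)) fun x hx => hx

theorem span_le {X : Set G} {Y : AffSet S G} (h : ∀ x ∈ X, x ∈ Y) : span S X ≤ Y :=
  fun _ hg => Y.closed (Aff.mono h hg)

theorem mem_span {X : Set G} {x : G} (hx : x ∈ X) : x ∈ span S X := Aff.of hx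

instance : SMul S (AffSet S G) where
  smul a X :=
    { carrier := {g | Aff X.carrier a g}
      closed := fun h => by simpa using h.bind (b := a) fun x hx => hx }

theorem smul_mem_smul (a : S) {X : AffSet S G} {g : G} (hg : g ∈ X) : a • g ∈ a • X :=
  Aff.smul_of a hg

theorem smul_mono (a : S) {X Y : AffSet S G} (h : X ≤ Y) : a • X ≤ a • Y :=
  fun _ hg => Aff.mono h hg

/-- The same coefficients serve for both components, so a combination of sums splits. With `w = 1`
this shows that a Minkowski sum is affine. -/
theorem exists_add_of_aff {X Y : Set G} {w : S} {g : G}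
    (hg : Aff {g | ∃ x ∈ X, ∃ y ∈ Y, x + y = g} w g) :
    ∃ x y, Aff X w x ∧ Aff Y w y ∧ x + y = g := by
  induction hg with
  | of h => obtain ⟨x, hx, y, hy, e⟩ := h; exact ⟨x, y, .of hx, .of hy, e⟩
  | smul a _ ih =>
    obtain ⟨x, y, hx, hy, e⟩ := ih
    exact ⟨_, _, hx.smul a, hy.smul a, by rw [← e, smul_add']⟩
  | add _ _ ih ih' =>
    obtain ⟨x, y, hx, hy, e⟩ := ih
    obtain ⟨x', y', hx', hy', e'⟩ := ih'
    exact ⟨_, _, hx.add hx', hy.add hy', by rw [← e, ← e']; ac_rfl⟩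

instance : Add (AffSet S G) where
  add X Y :=
    { carrier := {g | ∃ x ∈ X.carrier, ∃ y ∈ Y.carrier, x + y = g}
      closed := fun h => by
        obtain ⟨x, y, hx, hy, e⟩ := exists_add_of_aff h
        exact ⟨x, X.closed hx, y, Y.closed hy, e⟩ }

theorem mem_add {X Y : AffSet S G} {g : G} : g ∈ X + Y ↔ ∃ x ∈ X, ∃ y ∈ Y, x + y = g := Iff.rfl

theorem add_mem_add {X Y : AffSet S G} {x y : G} (hx : x ∈ X) (hy : y ∈ Y) : x + y ∈ X + Y :=
  ⟨x, hx, y, hy, rfl⟩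

theorem add_mono {X X' Y Y' : AffSet S G} (h : X ≤ X') (h' : Y ≤ Y') : X + Y ≤ X' + Y' := by
  rintro _ ⟨x, hx, y, hy, rfl⟩
  exact ⟨x, h hx, y, h' hy, rfl⟩

instance : AddCommSemigroup (AffSet S G) where
  add_assoc X Y Z := by
    ext g
    constructor
    · rintro ⟨_, ⟨x, hx, y, hy, rfl⟩, z, hz, rfl⟩
      exact ⟨x, hx, _, ⟨y, hy, z, hz, rfl⟩, (add_assoc x y z).symm⟩
    · rintro ⟨x, hx, _, ⟨y, hy, z, hz, rfl⟩, rfl⟩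
      exact ⟨_, ⟨x, hx, y, hy, rfl⟩, z, hz, add_assoc x y z⟩
  add_comm X Y := by
    ext g
    constructor <;>
    · rintro ⟨x, hx, y, hy, rfl⟩
      exact ⟨y, hy, x, hx, add_comm y x⟩

/-- Scalars need not be invertible and there is no zero vector. The nontrivial inclusions still
hold: a multiple of a point is added and subtracted again, and the leftover `0 • x` disappears
because the point is chosen to be absorbed. -/
instance : WeakModule S (AffSet S G) where
  one_smul X := by
    ext g
    exact ⟨fun h => X.closed h, fun h => Aff.of h⟩
  mul_smul a b X := by
    ext g
    refine ⟨fun h => ?_, fun h => Aff.bind (fun x hx => hx) h⟩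
    obtain ⟨x, hx, e⟩ := h.exists_absorb
    have h1 : b • x ∈ b • X := smul_mem_smul b hx
    -- Total coefficient `b + a * b - a * b = b`. Then `g` is `a • (b • x)` plus this point minus `b
    -- • x`, with total coefficient `a + 1 - 1`.
    have h2 : b • x + g + (-(a * b)) • x ∈ b • X :=
      (((Aff.smul_of b hx).add h).add (Aff.smul_of (-(a * b)) hx)).cast (by ring) rfl
    have h3 : Aff (b • X).carrier a
        (a • (b • x) + (b • x + g + (-(a * b)) • x) + (-1 : S) • (b • x)) :=
      (((Aff.smul_of a h1).add (Aff.of h2)).add (Aff.smul_of (-1) h1)).cast (by ring) rfl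
    refine h3.cast rfl ?_
    calc _ = g + (((a * b) • x + b • x) + ((-(a * b)) • x + (-1 * b) • x)) := by
          rw [smul_smul, smul_smul]; ac_rfl
      _ = g + (0 : S) • x := by
          rw [← add_smul', ← add_smul', ← add_smul']; congr 2; ring
      _ = g := e
  smul_add' a X Y := by
    ext g
    constructor
    · intro h
      obtain ⟨x, y, hx, hy, e⟩ := exists_add_of_aff h
      exact ⟨x, hx, y, hy, e⟩
    · rintro ⟨u, hu, v, hv, rfl⟩
      obtain ⟨x, hx, ex⟩ := Aff.exists_absorb hu
      obtain ⟨y, hy, ey⟩ := Aff.exists_absorb hv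
      -- The sum `u + v` is rebuilt as `(u + a • y) + (v + a • x) - a • (x + y)`, with total
      -- coefficient `a + a - a`.
      have h1 : Aff (X + Y).carrier a (u + a • y) :=
        Aff.translate y (fun z hz => add_mem_add hz hy) hu
      have h2 : Aff (X + Y).carrier a (v + a • x) :=
        Aff.translate x (fun z hz => add_comm x z ▸ add_mem_add hx hz) hv
      have h3 : Aff (X + Y).carrier (-a) ((-a) • (x + y)) :=
        Aff.smul_of (-a) (add_mem_add hx hy)
      refine ((h1.add h2).add h3).cast (by ring) ?_
      calc _ = (u + (a • x + (-a) • x)) + (v + (a • y + (-a) • y)) := by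
            rw [smul_add']; ac_rfl
        _ = (u + (0 : S) • x) + (v + (0 : S) • y) := by
            rw [← add_smul', ← add_smul', add_neg_cancel]
        _ = u + v := by rw [ex, ey]
  add_smul' a b X := by
    ext g
    constructor
    · intro h
      obtain ⟨x, hx, e⟩ := Aff.exists_absorb h
      -- The remainder has total coefficient `(a + b) - a = b`.
      refine ⟨a • x, smul_mem_smul a hx, g + (-a) • x,
        (Aff.add h (Aff.smul_of (-a) hx)).cast (by ring) rfl, ?_⟩
      calc _ = g + (a • x + (-a) • x) := by ac_rfl
        _ = g := by rw [← add_smul', add_neg_cancel, e]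
    · rintro ⟨u, hu, v, hv, rfl⟩
      exact Aff.add hu hv

/-- Sums are non-empty, so the empty set is affine, even after multiplication by 0. It serves as the
value at general variables, which can be neither applied nor matched with a domain. -/
instance : EmptyCollection (AffSet S G) where
  emptyCollection :=
    { carrier := ∅
      closed := fun h => (Aff.exists_absorb h).elim fun _ hx => hx.1 }

theorem notMem_empty (g : G) : g ∉ (∅ : AffSet S G) := id

theorem smul_empty (a : S) : a • (∅ : AffSet S G) = ∅ := by
  ext g
  exact ⟨fun h => (Aff.exists_absorb h).elim fun _ hx => hx.1.elim, fun h => h.elim⟩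

theorem empty_add_empty : (∅ : AffSet S G) + ∅ = ∅ := by
  ext g
  exact ⟨fun h => h.elim fun _ hx => hx.1.elim, fun h => h.elim⟩

end AffSet
end VecLambda

namespace VecLambda

universe u

variable {S : Type u}

/-! ### Substitution of type variables -/

namespace Ty

theorem subst_congr {σ τ : TySub S} (h : ∀ k n, σ k n = τ k n) {k : Kind} (T : Ty S k) :
    T.subst σ = T.subst τ := by
  have : σ = τ := funext fun k => funext fun n => h k n
  rw [this]

theorem lift_var (k k' : Kind) (n : ℕ) :
    TySub.lift (S := S) (fun k n => .var k n) k k' n = .var k' n := by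
  cases k <;> cases k' <;> cases n <;> rfl

theorem subst_var {k : Kind} (T : Ty S k) : T.subst (fun k n => .var k n) = T := by
  induction T with
  | var k n => rfl
  | arr U T ihU ihT => simp only [subst, ihU, ihT]
  | all k U ih => rw [subst, subst_congr (lift_var k), ih]
  | ofUnit U ih => simp only [subst, ih]
  | smul a T ih => simp only [subst, ih]
  | add T R ih ih' => simp only [subst, ih, ih']

theorem rename_eq_subst {k : Kind} (T : Ty S k) (ρ : TyRen) :
    T.rename ρ = T.subst fun k n => .var k (ρ k n) := by
  induction T generalizing ρ with
  | var k n => rfl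
  | arr U T ihU ihT => simp only [subst, rename, ihU, ihT]
  | all k U ih =>
    rw [subst, rename, ih]
    congr 1
    apply subst_congr
    intro k' n
    cases k <;> cases k' <;> cases n <;> rfl
  | ofUnit U ih => simp only [subst, rename, ih]
  | smul a T ih => simp only [subst, rename, ih]
  | add T R ih ih' => simp only [subst, rename, ih, ih']

theorem subst_rename {k : Kind} (T : Ty S k) (ρ : TyRen) (σ : TySub S) :
    (T.rename ρ).subst σ = T.subst fun k n => σ k (ρ k n) := by
  induction T generalizing ρ σ with
  | var k n => rfl
  | arr U T ihU ihT => simp only [subst, rename, ihU, ihT]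
  | all k U ih =>
    rw [subst, rename, subst, ih]
    congr 1
    apply subst_congr
    intro k' n
    cases k <;> cases k' <;> cases n <;> rfl
  | ofUnit U ih => simp only [subst, rename, ih]
  | smul a T ih => simp only [subst, rename, ih]
  | add T R ih ih' => simp only [subst, rename, ih, ih']

theorem rename_rename {k : Kind} (T : Ty S k) (ρ ρ' : TyRen) :
    (T.rename ρ).rename ρ' = T.rename fun k n => ρ' k (ρ k n) := by
  rw [rename_eq_subst _ ρ', subst_rename, rename_eq_subst]

theorem rename_shift_rename_lift {k : Kind} (T : Ty S k) (l : Kind) (ρ : TyRen) :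
    (T.rename (TyRen.shift l)).rename (ρ.lift l) = (T.rename ρ).rename (TyRen.shift l) := by
  rw [rename_rename, rename_rename]
  congr 1
  funext k n
  cases l <;> cases k <;> rfl

theorem rename_subst {k : Kind} (T : Ty S k) (σ : TySub S) (ρ : TyRen) :
    (T.subst σ).rename ρ = T.subst fun k n => (σ k n).rename ρ := by
  induction T generalizing ρ σ with
  | var k n => rfl
  | arr U T ihU ihT => simp only [subst, rename, ihU, ihT]
  | all k U ih =>
    rw [subst, rename, subst, ih]
    congr 1
    apply subst_congr
    intro k' n
    cases k <;> cases k' <;> cases n <;> first | rfl | apply rename_shift_rename_lift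
  | ofUnit U ih => simp only [subst, rename, ih]
  | smul a T ih => simp only [subst, rename, ih]
  | add T R ih ih' => simp only [subst, rename, ih, ih']

theorem subst_shift_lift {k : Kind} (T : Ty S k) (l : Kind) (σ : TySub S) :
    (T.rename (TyRen.shift l)).subst (σ.lift l) = (T.subst σ).rename (TyRen.shift l) := by
  rw [subst_rename, rename_subst]
  apply subst_congr
  intro k n
  cases l <;> cases k <;> rfl

theorem subst_subst {k : Kind} (T : Ty S k) (σ τ : TySub S) :
    (T.subst σ).subst τ = T.subst fun k n => (σ k n).subst τ := by
  induction T generalizing σ τ with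
  | var k n => rfl
  | arr U T ihU ihT => simp only [subst, ihU, ihT]
  | all k U ih =>
    rw [subst, subst, subst, ih]
    congr 1
    apply subst_congr
    intro k' n
    cases k <;> cases k' <;> cases n <;> first | rfl | apply subst_shift_lift
  | ofUnit U ih => simp only [subst, ih]
  | smul a T ih => simp only [subst, ih]
  | add T R ih ih' => simp only [subst, ih, ih']

/-- `T[A/X]`, where `X` is the variable `0` of the sort of `A`. -/
def inst {k k' : Kind} (T : Ty S k') (A : Ty S k) : Ty S k' :=
  T.subst (TySub.push ⟨k, A⟩ fun k n => .var k n)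

theorem inst_rename_shift {k k' : Kind} (A : Ty S k) (T : Ty S k') :
    (T.rename (TyRen.shift k)).inst A = T := by
  rw [inst, subst_rename]
  refine (subst_congr ?_ T).trans (subst_var T)
  intro l n
  cases k <;> cases l <;> rfl

theorem inst_subst_lift {k k' : Kind} (A : Ty S k) (T : Ty S k') (σ : TySub S) :
    (T.subst (σ.lift k)).inst A = T.subst (TySub.push ⟨k, A⟩ σ) := by
  rw [inst, subst_subst]
  apply subst_congr
  intro l n
  cases k <;> cases l <;> cases n <;> first | rfl | exact inst_rename_shift _ _

theorem subst_inst {k k' : Kind} (A : Ty S k) (T : Ty S k') (σ : TySub S) :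
    (T.inst A).subst σ = (T.subst (σ.lift k)).inst (A.subst σ) := by
  rw [inst_subst_lift, inst, subst_subst]
  apply subst_congr
  intro l n
  cases k <;> cases l <;> cases n <;> rfl

/-- Induction on the linear structure alone, with unit types as atoms. -/
theorem gen_induction {P : Ty S .gen → Prop} (var : ∀ n, P (.var .gen n))
    (ofUnit : ∀ U, P (.ofUnit U)) (smul : ∀ a T, P T → P (.smul a T))
    (add : ∀ T R, P T → P R → P (.add T R)) : ∀ T, P T
  | .var _ n => var n
  | .ofUnit U => ofUnit U
  | .smul a T => smul a T (gen_induction var ofUnit smul add T)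
  | .add T R => add T R (gen_induction var ofUnit smul add T) (gen_induction var ofUnit smul add R)

/-! ### Operations on the summands of a type -/

/-- All summands are unit types that satisfy `P`. -/
def All (P : Ty S .unit → Prop) : {k : Kind} → Ty S k → Prop
  | .unit, U => P U
  | _, .var .gen _ => False
  | _, .ofUnit U => P U
  | _, .smul _ T => T.All P
  | _, .add T R => T.All P ∧ R.All P

/-- Apply `f` to all unit summands. -/
def mapU (f : Ty S .unit → Ty S .unit) : {k : Kind} → Ty S k → Ty S k
  | .unit, U => f U
  | _, .var .gen n => .var .gen n
  | _, .ofUnit U => .ofUnit (f U)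
  | _, .smul a T => .smul a (T.mapU f)
  | _, .add T R => .add (T.mapU f) (R.mapU f)

theorem All.mono {P Q : Ty S .unit → Prop} (h : ∀ U, P U → Q U) {T : Ty S .gen} :
    T.All P → T.All Q := by
  induction T using gen_induction with
  | var n => exact id
  | ofUnit U => exact h U
  | smul a T ih => exact ih
  | add T R ih ih' => exact And.imp ih ih'

theorem All.mapU {P Q : Ty S .unit → Prop} {f : Ty S .unit → Ty S .unit}
    (h : ∀ U, P U → Q (f U)) {T : Ty S .gen} : T.All P → (T.mapU f).All Q := by
  induction T using gen_induction with
  | var n => exact id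
  | ofUnit U => exact h U
  | smul a T ih => exact ih
  | add T R ih ih' => exact And.imp ih ih'

theorem All.subst {P Q : Ty S .unit → Prop} {σ : TySub S}
    (h : ∀ U, P U → Q (U.subst σ)) {T : Ty S .gen} : T.All P → (T.subst σ).All Q := by
  induction T using gen_induction with
  | var n => exact False.elim
  | ofUnit U => exact h U
  | smul a T ih => exact ih
  | add T R ih ih' => exact And.imp ih ih'

theorem mapU_subst {P : Ty S .unit → Prop} {f g : Ty S .unit → Ty S .unit} {σ τ : TySub S}
    (h : ∀ U, P U → (f U).subst σ = g (U.subst τ)) {T : Ty S .gen} (hT : T.All P) :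
    (T.mapU f).subst σ = (T.subst τ).mapU g := by
  induction T using gen_induction with
  | var n => exact hT.elim
  | ofUnit U => exact congrArg Ty.ofUnit (h U hT)
  | smul a T ih => exact congrArg (Ty.smul a) (ih hT)
  | add T R ih ih' => exact congrArg₂ Ty.add (ih hT.1) (ih' hT.2)

inductive IsAll (k : Kind) : Ty S .unit → Prop
  | mk (U : Ty S .unit) : IsAll k (.all k U)

/-- Instantiate an outermost quantifier of the sort of `A`. -/
noncomputable def instAll {k : Kind} (A : Ty S k) : Ty S .unit → Ty S .unit
  | .all k' U => open Classical in if k' = k then U.inst A else .all k' U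
  | U => U

theorem instAll_all {k : Kind} (A : Ty S k) (U : Ty S .unit) : instAll A (.all k U) = U.inst A :=
  if_pos rfl

/-! ### Equivalence of types -/

variable [CommRing S]

instance setoid : Setoid (Ty S .gen) := ⟨Equiv, .refl, .symm, .trans⟩

/-- Unit types are equivalent with the same outermost constructor. -/
inductive Shape : Ty S .unit → Ty S .unit → Prop
  | var (n : ℕ) : Shape (.var .unit n) (.var .unit n)
  | arr {U V : Ty S .unit} {T R : Ty S .gen} :
      Equiv (.ofUnit U) (.ofUnit V) → Equiv T R → Shape (.arr U T) (.arr V R)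
  | all (k : Kind) {U V : Ty S .unit} : Equiv (.ofUnit U) (.ofUnit V) →
      Shape (.all k U) (.all k V)

namespace Shape

theorem refl : ∀ U : Ty S .unit, Shape U U
  | .var _ n => .var n
  | .arr _ _ => .arr (.refl _) (.refl _)
  | .all k _ => .all k (.refl _)

theorem symm {U V : Ty S .unit} (h : Shape U V) : Shape V U := by
  cases h with
  | var n => exact .var n
  | arr h h' => exact .arr h.symm h'.symm
  | all k h => exact .all k h.symm

theorem trans {U V W : Ty S .unit} (h : Shape U V) (h' : Shape V W) : Shape U W := by
  cases h with
  | var n => exact h'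
  | arr h1 h2 => cases h' with | arr h3 h4 => exact .arr (h1.trans h3) (h2.trans h4)
  | all k h => cases h' with | all _ h3 => exact .all k (h.trans h3)

theorem equiv {U V : Ty S .unit} (h : Shape U V) : Equiv (.ofUnit U) (.ofUnit V) := by
  cases h with
  | var n => exact .refl _
  | arr h1 h2 => exact .congr_arr h1 h2
  | all k h => exact .congr_all k h

end Shape

/-- The module axioms keep the set of unit summands. Only the two congruence rules for unit types
change a summand, and they stay within a `Shape`. -/
theorem Equiv.all_iff {P : Ty S .unit → Prop} (hP : ∀ U V, Shape U V → (P U ↔ P V))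
    {T R : Ty S .gen} (h : Equiv T R) : T.All P ↔ R.All P := by
  induction h with
  | one_smul => exact Iff.rfl
  | smul_smul => exact Iff.rfl
  | smul_add => exact Iff.rfl
  | add_smul => exact and_self_iff
  | add_comm => exact and_comm
  | add_assoc => exact and_assoc.symm
  | refl => exact Iff.rfl
  | symm _ ih => exact ih.symm
  | trans _ _ ih ih' => exact ih.trans ih'
  | congr_smul _ _ ih => exact ih
  | congr_add _ _ ih ih' => exact and_congr ih ih'
  | congr_arr h h' => exact hP _ _ (.arr h h')
  | congr_all k h => exact hP _ _ (.all k h)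

/-- Inversion without normal forms: `Shape U` is itself an invariant predicate on summands, by
transitivity, and it holds of `U`. -/
theorem Equiv.shape {U V : Ty S .unit} (h : Equiv (.ofUnit U) (.ofUnit V)) : Shape U V :=
  (Equiv.all_iff (P := Shape U)
    (fun _ _ h => ⟨fun h' => h'.trans h, fun h' => h'.trans h.symm⟩) h).1 (Shape.refl U)

theorem Equiv.all_congr {P : Ty S .unit → Prop}
    (hP : ∀ U V, Equiv (.ofUnit U) (.ofUnit V) → P U → P V)
    {T R : Ty S .gen} (h : Equiv T R) : T.All P → R.All P :=
  (Equiv.all_iff (fun _ _ h => ⟨hP _ _ h.equiv, hP _ _ h.symm.equiv⟩) h).1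

theorem Equiv.subst {T R : Ty S .gen} (h : Equiv T R) (σ : TySub S) :
    Equiv (T.subst σ) (R.subst σ) := by
  induction h generalizing σ with
  | one_smul => exact .one_smul _
  | smul_smul => exact .smul_smul _ _ _
  | smul_add => exact .smul_add _ _ _
  | add_smul => exact .add_smul _ _ _
  | add_comm => exact .add_comm _ _
  | add_assoc => exact .add_assoc _ _ _
  | refl => exact .refl _
  | symm _ ih => exact (ih σ).symm
  | trans _ _ ih ih' => exact (ih σ).trans (ih' σ)
  | congr_smul _ _ ih => exact .congr_smul _ (ih σ)
  | congr_add _ _ ih ih' => exact .congr_add (ih σ) (ih' σ)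
  | congr_arr _ _ ih ih' => exact .congr_arr (ih σ) (ih' σ)
  | congr_all k _ ih => exact .congr_all k (ih _)

theorem Equiv.mapU {f : Ty S .unit → Ty S .unit}
    (hf : ∀ U V, Shape U V → Equiv (.ofUnit (f U)) (.ofUnit (f V)))
    {T R : Ty S .gen} (h : Equiv T R) : Equiv (T.mapU f) (R.mapU f) := by
  induction h with
  | one_smul => exact .one_smul _
  | smul_smul => exact .smul_smul _ _ _
  | smul_add => exact .smul_add _ _ _
  | add_smul => exact .add_smul _ _ _
  | add_comm => exact .add_comm _ _
  | add_assoc => exact .add_assoc _ _ _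
  | refl => exact .refl _
  | symm _ ih => exact ih.symm
  | trans _ _ ih ih' => exact ih.trans ih'
  | congr_smul _ _ ih => exact .congr_smul _ ih
  | congr_add _ _ ih ih' => exact .congr_add ih ih'
  | congr_arr h h' => exact hf _ _ (.arr h h')
  | congr_all k h => exact hf _ _ (.all k h)

theorem equiv_all {k : Kind} (U V : Ty S .unit) (h : Shape U V) :
    Equiv (.ofUnit (.all k U)) (.ofUnit (.all k V)) := .congr_all k h.equiv

theorem equiv_instAll {k : Kind} (A : Ty S k) (U V : Ty S .unit) (h : Shape U V) :
    Equiv (.ofUnit (instAll A U)) (.ofUnit (instAll A V)) := by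
  cases h with
  | var n => exact .refl _
  | arr h1 h2 => exact .congr_arr h1 h2
  | all k' h =>
    by_cases e : k' = k
    · simp only [instAll, if_pos e]
      exact h.subst _
    · simp only [instAll, if_neg e]
      exact .congr_all _ h

theorem IsAll.congr {k : Kind} (U V : Ty S .unit) (h : Equiv (.ofUnit U) (.ofUnit V)) :
    IsAll k U → IsAll k V := by
  rintro ⟨U⟩
  cases h.shape with | all _ _ => exact .mk _

theorem Equiv.weight {T R : Ty S .gen} (h : Equiv T R) : T.weight = R.weight := by
  induction h with
  | one_smul T => cases h : T.weight <;> simp [Ty.weight, h]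
  | smul_smul a b T => cases h : T.weight <;> simp [Ty.weight, h, mul_assoc]
  | smul_add a T R =>
    cases h : T.weight <;> cases h' : R.weight <;> simp [Ty.weight, h, h', mul_add]
  | add_smul a b T => cases h : T.weight <;> simp [Ty.weight, h, add_mul]
  | add_comm T R =>
    cases h : T.weight <;> cases h' : R.weight <;> simp [Ty.weight, h, h', _root_.add_comm]
  | add_assoc T R Q =>
    cases h : T.weight <;> cases h' : R.weight <;> cases h'' : Q.weight <;>
      simp [Ty.weight, h, h', h'', _root_.add_assoc]
  | refl => rfl
  | symm _ ih => exact ih.symm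
  | trans _ _ ih ih' => exact ih.trans ih'
  | congr_smul _ _ ih => simp only [Ty.weight, ih]
  | congr_add _ _ ih ih' => simp only [Ty.weight, ih, ih']
  | congr_arr h h' => rfl
  | congr_all k h => rfl

theorem weight_mapU (f : Ty S .unit → Ty S .unit) (T : Ty S .gen) :
    (T.mapU f).weight = T.weight := by
  induction T using gen_induction with
  | var n => rfl
  | ofUnit U => rfl
  | smul a T ih => simp only [Ty.mapU, Ty.weight, ih]
  | add T R ih ih' => simp only [Ty.mapU, Ty.weight, ih, ih']

/-! ### The weak module of types -/

variable (S) in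
/-- Types up to equivalence. -/
def Cls : Type u := Quotient (setoid (S := S))

/-- The class of a type. -/
def cls (T : Ty S .gen) : Cls S := Quotient.mk _ T

theorem cls_eq {T R : Ty S .gen} : T.cls = R.cls ↔ Equiv T R := Quotient.eq

theorem exists_cls (g : Cls S) : ∃ T : Ty S .gen, T.cls = g := Quotient.exists_rep g

instance : AddCommSemigroup (Cls S) where
  add := Quotient.map₂ .add fun _ _ h _ _ h' => .congr_add h h'
  add_assoc := by
    rintro ⟨T⟩ ⟨R⟩ ⟨Q⟩
    exact Quotient.sound (Equiv.add_assoc T R Q).symm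
  add_comm := by
    rintro ⟨T⟩ ⟨R⟩
    exact Quotient.sound (Equiv.add_comm T R)

instance : WeakModule S (Cls S) where
  smul a := Quotient.map (.smul a) fun _ _ h => .congr_smul a h
  one_smul := by
    rintro ⟨T⟩
    exact Quotient.sound (Equiv.one_smul T)
  mul_smul a b := by
    rintro ⟨T⟩
    exact Quotient.sound (Equiv.smul_smul a b T).symm
  smul_add' a := by
    rintro ⟨T⟩ ⟨R⟩
    exact Quotient.sound (Equiv.smul_add a T R).symm
  add_smul' a b := by
    rintro ⟨T⟩
    exact Quotient.sound (Equiv.add_smul a b T).symm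

theorem cls_add (T R : Ty S .gen) : (Ty.add T R).cls = T.cls + R.cls := rfl

section ext

variable {H : Type*} [AddCommSemigroup H] [WeakModule S H]

/-- The extension of maps on unit types and on variables to all types. -/
def ext (F : Ty S .unit → H) (v : ℕ → H) : {k : Kind} → Ty S k → H
  | .unit, U => F U
  | _, .var .gen n => v n
  | _, .ofUnit U => F U
  | _, .smul a T => a • T.ext F v
  | _, .add T R => T.ext F v + R.ext F v

/-- Freeness of `Cls S` on the classes of unit types and the general variables. -/
theorem Equiv.ext {F : Ty S .unit → H} {v : ℕ → H} (hF : ∀ U V, Shape U V → F U = F V)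
    {T R : Ty S .gen} (h : Equiv T R) : T.ext F v = R.ext F v := by
  induction h with
  | one_smul => exact _root_.one_smul S _
  | smul_smul => exact _root_.smul_smul _ _ _
  | smul_add => exact (WeakModule.smul_add' _ _ _).symm
  | add_smul => exact (WeakModule.add_smul' _ _ _).symm
  | add_comm => exact _root_.add_comm _ _
  | add_assoc => exact (_root_.add_assoc _ _ _).symm
  | refl => rfl
  | symm _ ih => exact ih.symm
  | trans _ _ ih ih' => exact ih.trans ih'
  | congr_smul a _ ih => exact congrArg (a • ·) ih
  | congr_add _ _ ih ih' => exact congrArg₂ (· + ·) ih ih'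
  | congr_arr h h' => exact hF _ _ (.arr h h')
  | congr_all k h => exact hF _ _ (.all k h)

end ext

end Ty
end VecLambda

namespace VecLambda

universe u

variable {S : Type u} [CommRing S]

open WeakModule Ty

/-! ### Types of applications -/

namespace Ty

/-- `Inst V W`: instantiating outermost quantifiers of `V` gives `W`, up to equivalence. -/
inductive Inst : Ty S .unit → Ty S .unit → Prop
  | of {V W : Ty S .unit} : Equiv (.ofUnit V) (.ofUnit W) → Inst V W
  | step {V V' W : Ty S .unit} {k : Kind} (A : Ty S k) :
      Equiv (.ofUnit V) (.ofUnit (.all k V')) → Inst (V'.inst A) W → Inst V W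

theorem Inst.congr_left {V V' W : Ty S .unit} (e : Equiv (.ofUnit V) (.ofUnit V')) :
    Inst V' W → Inst V W
  | .of h => .of (e.trans h)
  | .step A h h' => .step A (e.trans h) h'

theorem Inst.congr_right {V W W' : Ty S .unit} (h : Inst V W)
    (e : Equiv (.ofUnit W) (.ofUnit W')) : Inst V W' := by
  induction h with
  | of h => exact .of (h.trans e)
  | step A h _ ih => exact .step A h (ih e)

theorem Inst.subst {V W : Ty S .unit} (h : Inst V W) (σ : TySub S) :
    Inst (V.subst σ) (W.subst σ) := by
  induction h with
  | of h => exact .of (h.subst σ)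
  | step A h _ ih =>
    refine .step (A.subst σ) (h.subst σ) ?_
    rw [← subst_inst]
    exact ih

/-- With the accumulator `σ` generalised, each type pushed by the simultaneous substitution is one
`Inst.step`. -/
theorem inst_allN (ks : List Kind) (U : Ty S .unit) (σ : TySub S) (As : List (Σ k, Ty S k))
    (h : As.map Sigma.fst = ks) :
    Inst ((allN ks U).subst σ) (U.subst (As.foldl (fun σ A => TySub.push A σ) σ)) := by
  induction As generalizing ks σ with
  | nil => subst h; exact .of (.refl _)
  | cons A As ih =>
    subst h
    refine .step A.2 (.refl _) ?_
    rw [inst_subst_lift]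
    exact ih _ _ rfl

/-- The types of an application of a function of type `V` to an argument of type `R`. -/
def outTy (V : Ty S .unit) (R : Ty S .gen) : AffSet S (Cls S) :=
  R.ext (fun U => AffSet.span S (cls '' {T | Inst V (.arr U T)})) fun _ => ∅

/-- The types of an application of a term of type `T` to a term of type `R`. -/
def appTy (T R : Ty S .gen) : AffSet S (Cls S) :=
  T.ext (fun V => outTy V R) fun _ => ∅

theorem outTy_congr {V V' : Ty S .unit} (hV : Shape V V') {R R' : Ty S .gen} (hR : Equiv R R') :
    outTy V R = outTy V' R' := by
  have : ∀ U, {T | Inst V (.arr U T)} = {T | Inst V' (.arr U T)} := fun U => Set.ext fun T =>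
    ⟨fun h => h.congr_left hV.symm.equiv, fun h => h.congr_left hV.equiv⟩
  simp only [outTy, this]
  refine hR.ext fun U U' h => ?_
  congr 3
  ext T
  exact ⟨fun h' => h'.congr_right (.congr_arr h.equiv (.refl _)),
    fun h' => h'.congr_right (.congr_arr h.symm.equiv (.refl _))⟩

theorem appTy_congr {T T' R R' : Ty S .gen} (hT : Equiv T T') (hR : Equiv R R') :
    appTy T R = appTy T' R' := by
  have : ∀ V : Ty S .unit, outTy V R = outTy V R' := fun V => outTy_congr (.refl V) hR
  simp only [appTy, this]
  exact hT.ext fun V V' h => outTy_congr h (.refl _)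

theorem appTy_add_left (T T' R : Ty S .gen) :
    appTy (.add T T') R = appTy T R + appTy T' R := rfl

theorem appTy_smul_left (a : S) (T R : Ty S .gen) : appTy (.smul a T) R = a • appTy T R := rfl

/-- The extension in `T` is the outer one, so linearity on the left is definitional, while on the
right it takes an induction that uses the laws of affine sets. -/
theorem appTy_add_right (T R R' : Ty S .gen) :
    appTy T (.add R R') = appTy T R + appTy T R' := by
  induction T using gen_induction with
  | var n => exact AffSet.empty_add_empty.symm
  | ofUnit V => rfl
  | smul a T ih => rw [appTy_smul_left, ih, smul_add']; rfl
  | add T T' ih ih' =>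
    rw [appTy_add_left, ih, ih', appTy_add_left, appTy_add_left]
    ac_rfl

theorem appTy_smul_right (a : S) (T R : Ty S .gen) : appTy T (.smul a R) = a • appTy T R := by
  induction T using gen_induction with
  | var n => exact (AffSet.smul_empty a).symm
  | ofUnit V => rfl
  | smul b T ih => rw [appTy_smul_left, ih, smul_smul, mul_comm, ← smul_smul]; rfl
  | add T T' ih ih' => rw [appTy_add_left, ih, ih', appTy_add_left, smul_add']

/-- The combinations in `ext` are bounded by the weight. -/
theorem ext_le_smul {G : Type*} [AddCommSemigroup G] [WeakModule S G]
    {F : Ty S .unit → AffSet S G} {v : ℕ → AffSet S G} {Z : AffSet S G} {T : Ty S .gen} {w : S}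
    (hT : T.All fun U => F U ≤ Z) (hw : T.weight = some w) : T.ext F v ≤ w • Z := by
  induction T using gen_induction generalizing w with
  | var n => exact hT.elim
  | ofUnit U =>
    cases hw
    rw [one_smul]
    exact hT
  | smul a T ih =>
    obtain ⟨w', hw', rfl⟩ := Option.map_eq_some_iff.1 hw
    rw [mul_smul]
    exact AffSet.smul_mono a (ih hT hw')
  | add T R ih ih' =>
    obtain ⟨w1, w2, h1, h2, rfl⟩ := Option.map₂_eq_some_iff.1 hw
    rw [add_smul']
    exact AffSet.add_mono (ih hT.1 h1) (ih' hT.2 h2)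

/-! ### Affine combinations of types -/

theorem Equiv.of_cls_add {T T1 T2 : Ty S .gen} (h : T.cls = T1.cls + T2.cls) :
    Equiv T (.add T1 T2) := cls_eq.1 h

/-- Linear operations on types carry combinations to combinations with the same coefficient.
Representatives are known only up to equivalence, hence the invariance conditions; `Q` is a side
condition inherited by summands. -/
theorem aff_map {X Y : Set (Cls S)} {Q : Ty S .gen → Prop} {φ : Ty S .gen → Ty S .gen}
    (hQ : ∀ {T R}, Equiv T R → Q T → Q R) (hQs : ∀ {a T}, Q (.smul a T) → Q T)
    (hQa : ∀ {T R}, Q (.add T R) → Q T ∧ Q R)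
    (hφ : ∀ {T R}, Equiv T R → Equiv (φ T) (φ R))
    (hφs : ∀ a T, φ (.smul a T) = .smul a (φ T))
    (hφa : ∀ T R, φ (.add T R) = .add (φ T) (φ R))
    (h : ∀ R : Ty S .gen, R.cls ∈ X → Q R → (φ R).cls ∈ Y)
    {w : S} {T : Ty S .gen} (hT : Aff X w T.cls) (hQT : Q T) : Aff Y w (φ T).cls := by
  generalize e : T.cls = g at hT
  induction hT generalizing T with
  | of hx => exact .of (h _ (e ▸ hx) hQT)
  | @smul a w g _ ih =>
    obtain ⟨T', rfl⟩ := exists_cls g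
    have e' : Equiv T (.smul a T') := cls_eq.1 e
    refine (Aff.smul a (ih (hQs (hQ e' hQT)) rfl)).cast rfl ?_
    rw [cls_eq.2 (hφ e'), hφs]
    rfl
  | @add w w' g g' _ _ ih ih' =>
    obtain ⟨T1, rfl⟩ := exists_cls g
    obtain ⟨T2, rfl⟩ := exists_cls g'
    have e' : Equiv T (.add T1 T2) := cls_eq.1 e
    have hQ' := hQa (hQ e' hQT)
    refine (Aff.add (ih hQ'.1 rfl) (ih' hQ'.2 rfl)).cast rfl ?_
    rw [cls_eq.2 (hφ e'), hφa]
    rfl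

theorem aff_subst {X Y : Set (Cls S)} (σ : TySub S)
    (h : ∀ R : Ty S .gen, R.cls ∈ X → (R.subst σ).cls ∈ Y)
    {w : S} {T : Ty S .gen} (hT : Aff X w T.cls) : Aff Y w (T.subst σ).cls :=
  aff_map (Q := fun _ => True) (fun _ => id) id (fun _ => ⟨trivial, trivial⟩)
    (fun h => h.subst σ) (fun _ _ => rfl) (fun _ _ => rfl) (fun R hR _ => h R hR) hT trivial

theorem aff_mapU {X Y : Set (Cls S)} {P : Ty S .unit → Prop} {f : Ty S .unit → Ty S .unit}
    (hP : ∀ U V : Ty S .unit, Equiv (.ofUnit U) (.ofUnit V) → P U → P V)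
    (hf : ∀ U V, Shape U V → Equiv (.ofUnit (f U)) (.ofUnit (f V)))
    (h : ∀ R : Ty S .gen, R.cls ∈ X → R.All P → (R.mapU f).cls ∈ Y)
    {w : S} {T : Ty S .gen} (hT : Aff X w T.cls) (hTP : T.All P) : Aff Y w (T.mapU f).cls :=
  aff_map (Q := fun T => T.All P) (fun e => e.all_congr hP) id id
    (fun e => e.mapU hf) (fun _ _ => rfl) (fun _ _ => rfl) h hT hTP

theorem aff_all {p : Ty S .unit → Prop} {P : Set (Ty S .gen)}
    (hp : ∀ U V : Ty S .unit, Equiv (.ofUnit U) (.ofUnit V) → p U → p V)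
    (h : ∀ R ∈ P, R.All p) {w : S} {T : Ty S .gen} (hT : Aff (cls '' P) w T.cls) : T.All p := by
  generalize e : T.cls = g at hT
  induction hT generalizing T with
  | of hx =>
    obtain ⟨R, hR, e'⟩ := hx
    exact (cls_eq.1 (e'.trans e.symm)).all_congr hp (h R hR)
  | @smul a w g _ ih =>
    obtain ⟨T', rfl⟩ := exists_cls g
    have e' : Equiv (.smul a T') T := cls_eq.1 e.symm
    exact e'.all_congr hp (show T'.All p from ih rfl)
  | @add w w' g g' _ _ ih ih' =>
    obtain ⟨T1, rfl⟩ := exists_cls g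
    obtain ⟨T2, rfl⟩ := exists_cls g'
    have e' : Equiv (.add T1 T2) T := cls_eq.1 e.symm
    exact e'.all_congr hp ⟨ih rfl, ih' rfl⟩

theorem aff_weight {P : Set (Ty S .gen)} {w : S} (h : ∀ R ∈ P, R.weight = some w)
    {a : S} {T : Ty S .gen} (hT : Aff (cls '' P) a T.cls) : T.weight = some (a * w) := by
  generalize e : T.cls = g at hT
  induction hT generalizing T with
  | of hx =>
    obtain ⟨R, hR, e'⟩ := hx
    rw [← (cls_eq.1 (e'.trans e.symm)).weight, h R hR, one_mul]
  | @smul a a' g _ ih =>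
    obtain ⟨T', rfl⟩ := exists_cls g
    have e' : Equiv (.smul a T') T := cls_eq.1 e.symm
    rw [← e'.weight, Ty.weight, ih rfl, mul_assoc]
    rfl
  | @add a a' g g' _ _ ih ih' =>
    obtain ⟨T1, rfl⟩ := exists_cls g
    obtain ⟨T2, rfl⟩ := exists_cls g'
    have e' : Equiv (.add T1 T2) T := cls_eq.1 e.symm
    rw [← e'.weight, Ty.weight, ih rfl, ih' rfl, add_mul]
    rfl

/-- Moves a scalar out of an application: `α·t` may be typed by a mixture of many types of `t`, of
total coefficient `α`. -/
theorem appTy_le_of_aff_left {X : Set (Cls S)} {R : Ty S .gen} {Z : AffSet S (Cls S)}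
    (h : ∀ T : Ty S .gen, T.cls ∈ X → appTy T R ≤ Z) {w : S} {T : Ty S .gen}
    (hT : Aff X w T.cls) : appTy T R ≤ w • Z := by
  generalize e : T.cls = g at hT
  induction hT generalizing T with
  | of hx => rw [one_smul]; exact h T (e ▸ hx)
  | @smul a a' g _ ih =>
    obtain ⟨T', rfl⟩ := exists_cls g
    rw [appTy_congr (R' := R) (cls_eq.1 e : Equiv T (.smul a T')) (.refl _), appTy_smul_left,
      mul_smul]
    exact AffSet.smul_mono a (ih rfl)
  | @add a a' g g' _ _ ih ih' =>
    obtain ⟨T1, rfl⟩ := exists_cls g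
    obtain ⟨T2, rfl⟩ := exists_cls g'
    rw [appTy_congr (R' := R) (cls_eq.1 e : Equiv T (.add T1 T2)) (.refl _), appTy_add_left,
      add_smul']
    exact AffSet.add_mono (ih rfl) (ih' rfl)

theorem appTy_le_of_aff_right {X : Set (Cls S)} {T : Ty S .gen} {Z : AffSet S (Cls S)}
    (h : ∀ R : Ty S .gen, R.cls ∈ X → appTy T R ≤ Z) {w : S} {R : Ty S .gen}
    (hR : Aff X w R.cls) : appTy T R ≤ w • Z := by
  generalize e : R.cls = g at hR
  induction hR generalizing R with
  | of hx => rw [one_smul]; exact h R (e ▸ hx)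
  | @smul a a' g _ ih =>
    obtain ⟨R', rfl⟩ := exists_cls g
    rw [appTy_congr (T' := T) (.refl _) (cls_eq.1 e : Equiv R (.smul a R')), appTy_smul_right,
      mul_smul]
    exact AffSet.smul_mono a (ih rfl)
  | @add a a' g g' _ _ ih ih' =>
    obtain ⟨R1, rfl⟩ := exists_cls g
    obtain ⟨R2, rfl⟩ := exists_cls g'
    rw [appTy_congr (T' := T) (.refl _) (cls_eq.1 e : Equiv R (.add R1 R2)), appTy_add_right,
      add_smul']
    exact AffSet.add_mono (ih rfl) (ih' rfl)

/-- A general variable may become an arbitrary type under `σ`; the empty value makes that case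
vacuous. -/
theorem subst_mem_ext {F F' : Ty S .unit → AffSet S (Cls S)} {v v' : ℕ → AffSet S (Cls S)}
    (σ : TySub S) {T : Ty S .gen} (hv : ∀ n, v n = ∅)
    (hF : ∀ U (Q : Ty S .gen), Q.cls ∈ F U → (Q.subst σ).cls ∈ F' (U.subst σ))
    {Q : Ty S .gen} (hQ : Q.cls ∈ T.ext F v) : (Q.subst σ).cls ∈ (T.subst σ).ext F' v' := by
  induction T using gen_induction generalizing Q with
  | var n =>
    have : Q.cls ∈ v n := hQ
    rw [hv n] at this
    exact (AffSet.notMem_empty _ this).elim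
  | ofUnit U => exact hF U Q hQ
  | smul a T ih => exact aff_subst σ (fun R hR => ih hR) hQ
  | add T R ih ih' =>
    obtain ⟨g1, h1, g2, h2, e⟩ := AffSet.mem_add.1 hQ
    obtain ⟨Q1, rfl⟩ := exists_cls g1
    obtain ⟨Q2, rfl⟩ := exists_cls g2
    rw [cls_eq.2 ((Equiv.of_cls_add e.symm).subst σ)]
    exact AffSet.add_mem_add (ih h1) (ih' h2)

theorem subst_mem_appTy (σ : TySub S) {T R Q : Ty S .gen} (hQ : Q.cls ∈ appTy T R) :
    (Q.subst σ).cls ∈ appTy (T.subst σ) (R.subst σ) := by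
  refine subst_mem_ext σ (fun _ => rfl) (fun V Q hQ => ?_) hQ
  refine subst_mem_ext σ (fun _ => rfl) (fun U Q hQ => ?_) hQ
  refine aff_subst σ ?_ hQ
  rintro Q' ⟨Q, hQ, e⟩
  rw [← cls_eq.2 ((cls_eq.1 e).subst σ)]
  exact ⟨_, hQ.subst σ, rfl⟩

end Ty
end VecLambda

namespace VecLambda

universe u

variable {S : Type u}

open WeakModule Ty

/-- Contexts under a binder of sort `k`. -/
abbrev shiftCtx (k : Kind) (Γ : List (Ty S .unit)) : List (Ty S .unit) :=
  Γ.map (Ty.rename (TyRen.shift k))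

theorem shiftCtx_subst_lift (k : Kind) (Γ : List (Ty S .unit)) (σ : TySub S) :
    (shiftCtx k Γ).map (Ty.subst (σ.lift k)) = shiftCtx k (Γ.map (Ty.subst σ)) := by
  simp only [shiftCtx, List.map_map]
  congr 1
  funext U
  exact subst_shift_lift U k σ

theorem shiftCtx_inst (k : Kind) (A : Ty S k) (Γ : List (Ty S .unit)) :
    (shiftCtx k Γ).map (Ty.subst (TySub.push ⟨k, A⟩ fun k n => .var k n)) = Γ := by
  simp only [shiftCtx, List.map_map]
  conv_rhs => rw [← List.map_id Γ]
  congr 1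
  funext U
  exact inst_rename_shift A U

theorem liftRen_id : liftRen id = id := by
  funext n
  cases n <;> rfl

theorem Term.rename_id (t : Term S) : t.rename id = t := by
  induction t with
  | var n => rfl
  | lam t ih => rw [Term.rename, liftRen_id, ih]
  | app t r ih ih' => rw [Term.rename, ih, ih']
  | smul a t ih => rw [Term.rename, ih]
  | add t r ih ih' => rw [Term.rename, ih, ih']

namespace Ty

theorem sum_all {P : Ty S .unit → Prop} {n : ℕ} {f : Fin (n + 1) → Ty S .gen}
    (h : ∀ i, (f i).All P) : (Ty.sum f).All P := by
  induction n with
  | zero => exact h 0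
  | succ n ih => exact ⟨ih fun i => h _, h _⟩

theorem sum_mapU (g : Ty S .unit → Ty S .unit) {n : ℕ} (f : Fin (n + 1) → Ty S .gen) :
    (Ty.sum f).mapU g = Ty.sum fun i => (f i).mapU g := by
  induction n with
  | zero => rfl
  | succ n ih => exact congrArg₂ Ty.add (ih _) rfl

end Ty

variable [CommRing S]

/-! ### Typing up to affine combinations -/

/-- A presentation of typing in which the rule for `1 • t` is replaced by affine combinations, and
in which linear combinations are read off from the syntax of types. -/
inductive Typing : List (Ty S .unit) → Term S → Ty S .gen → Prop
  | ax {Γ : List (Ty S .unit)} {n : ℕ} {U : Ty S .unit} :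
      Γ[n]? = some U → Typing Γ (.var n) (.ofUnit U)
  | lam {Γ : List (Ty S .unit)} {t : Term S} {U : Ty S .unit} {T : Ty S .gen} :
      Typing (U :: Γ) t T → Typing Γ (.lam t) (.ofUnit (.arr U T))
  | app {Γ : List (Ty S .unit)} {t r : Term S} {T R Q : Ty S .gen} :
      Typing Γ t T → Typing Γ r R → Q.cls ∈ appTy T R → Typing Γ (.app t r) Q
  | add {Γ : List (Ty S .unit)} {t r : Term S} {T R : Ty S .gen} :
      Typing Γ t T → Typing Γ r R → Typing Γ (.add t r) (.add T R)
  | smul {Γ : List (Ty S .unit)} {t : Term S} {a : S} {T : Ty S .gen} (P : Set (Ty S .gen)) :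
      (∀ R ∈ P, Typing Γ t R) → Aff (cls '' P) a T.cls → Typing Γ (.smul a t) T
  | aff {Γ : List (Ty S .unit)} {t : Term S} {T : Ty S .gen} (P : Set (Ty S .gen)) :
      (∀ R ∈ P, Typing Γ t R) → Aff (cls '' P) (1 : S) T.cls → Typing Γ t T
  | all_intro {Γ : List (Ty S .unit)} {t : Term S} {T : Ty S .gen} (k : Kind) :
      Typing (shiftCtx k Γ) t T → T.All (fun _ => True) → Typing Γ t (T.mapU (.all k))
  | all_elim {Γ : List (Ty S .unit)} {t : Term S} {T : Ty S .gen} {k : Kind} (A : Ty S k) :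
      Typing Γ t T → T.All (IsAll k) → Typing Γ t (T.mapU (instAll A))

namespace Typing

theorem equiv {Γ : List (Ty S .unit)} {t : Term S} {T R : Ty S .gen} (h : Typing Γ t T)
    (e : Equiv T R) : Typing Γ t R :=
  .aff {T} (by rintro _ rfl; exact h) (Aff.of ⟨T, rfl, cls_eq.2 e⟩)

end Typing

/-- The types of a term, up to equivalence. -/
def typesOf (Γ : List (Ty S .unit)) (t : Term S) : AffSet S (Cls S) where
  carrier := cls '' {T | Typing Γ t T}
  closed {g} h := by
    obtain ⟨T, rfl⟩ := exists_cls g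
    exact ⟨T, .aff _ (fun _ h => h) h, rfl⟩

theorem mem_typesOf {Γ : List (Ty S .unit)} {t : Term S} {T : Ty S .gen} :
    T.cls ∈ typesOf Γ t ↔ Typing Γ t T :=
  ⟨fun ⟨_, h, e⟩ => h.equiv (cls_eq.1 e), fun h => ⟨T, h, rfl⟩⟩

/-- Predicates closed under the typing rules that do not depend on the term. -/
structure Stable (Q : List (Ty S .unit) → Ty S .gen → Prop) : Prop where
  aff : ∀ Γ T (P : Set (Ty S .gen)), (∀ R ∈ P, Q Γ R) → Aff (cls '' P) (1 : S) T.cls → Q Γ T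
  all_intro : ∀ Γ T k, Q (shiftCtx k Γ) T → T.All (fun _ => True) → Q Γ (T.mapU (.all k))
  all_elim : ∀ Γ T k (A : Ty S k), Q Γ T → T.All (IsAll k) → Q Γ (T.mapU (instAll A))

theorem stable_typing (t : Term S) : Stable fun Γ T => Typing Γ t T where
  aff _ _ P h h' := .aff P h h'
  all_intro _ _ k h h' := .all_intro k h h'
  all_elim _ _ _ A h h' := .all_elim A h h'

/-! ### Generation principles for terms of a given form -/

namespace Typing

variable {Q : List (Ty S .unit) → Ty S .gen → Prop}

/-- Three rules ignore the form of the term and may follow the syntax-directed one in any order;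
stability covers them. `Q` depends on the context because introducing a quantifier shifts it. -/
theorem var_ind (hQ : Stable Q) {n : ℕ} (h : ∀ Γ U, Γ[n]? = some U → Q Γ (.ofUnit U))
    {Γ : List (Ty S .unit)} {T : Ty S .gen} (ht : Typing Γ (.var n) T) : Q Γ T := by
  generalize e : Term.var n = u at ht
  induction ht with
  | ax h' => cases e; exact h _ _ h'
  | lam | app | add | smul => cases e
  | aff P _ h' ih => exact hQ.aff _ _ P (fun R hR => ih R hR e) h'
  | all_intro k _ h' ih => exact hQ.all_intro _ _ k (ih e) h'
  | all_elim A _ h' ih => exact hQ.all_elim _ _ _ A (ih e) h'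

theorem lam_ind (hQ : Stable Q) {t : Term S}
    (h : ∀ Γ U T, Typing (U :: Γ) t T → Q Γ (.ofUnit (.arr U T)))
    {Γ : List (Ty S .unit)} {T : Ty S .gen} (ht : Typing Γ (.lam t) T) : Q Γ T := by
  generalize e : Term.lam t = u at ht
  induction ht with
  | lam h' => cases e; exact h _ _ _ h'
  | ax | app | add | smul => cases e
  | aff P _ h' ih => exact hQ.aff _ _ P (fun R hR => ih R hR e) h'
  | all_intro k _ h' ih => exact hQ.all_intro _ _ k (ih e) h'
  | all_elim A _ h' ih => exact hQ.all_elim _ _ _ A (ih e) h'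

theorem app_ind (hQ : Stable Q) {t r : Term S}
    (h : ∀ Γ T R T', Typing Γ t T → Typing Γ r R → T'.cls ∈ appTy T R → Q Γ T')
    {Γ : List (Ty S .unit)} {T : Ty S .gen} (ht : Typing Γ (.app t r) T) : Q Γ T := by
  generalize e : Term.app t r = u at ht
  induction ht with
  | app h1 h2 h3 => cases e; exact h _ _ _ _ h1 h2 h3
  | ax | lam | add | smul => cases e
  | aff P _ h' ih => exact hQ.aff _ _ P (fun R hR => ih R hR e) h'
  | all_intro k _ h' ih => exact hQ.all_intro _ _ k (ih e) h'
  | all_elim A _ h' ih => exact hQ.all_elim _ _ _ A (ih e) h'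

theorem add_ind (hQ : Stable Q) {t r : Term S}
    (h : ∀ Γ T R, Typing Γ t T → Typing Γ r R → Q Γ (.add T R))
    {Γ : List (Ty S .unit)} {T : Ty S .gen} (ht : Typing Γ (.add t r) T) : Q Γ T := by
  generalize e : Term.add t r = u at ht
  induction ht with
  | add h1 h2 => cases e; exact h _ _ _ h1 h2
  | ax | lam | app | smul => cases e
  | aff P _ h' ih => exact hQ.aff _ _ P (fun R hR => ih R hR e) h'
  | all_intro k _ h' ih => exact hQ.all_intro _ _ k (ih e) h'
  | all_elim A _ h' ih => exact hQ.all_elim _ _ _ A (ih e) h'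

theorem smul_ind (hQ : Stable Q) {a : S} {t : Term S}
    (h : ∀ Γ T, T.cls ∈ a • typesOf Γ t → Q Γ T)
    {Γ : List (Ty S .unit)} {T : Ty S .gen} (ht : Typing Γ (.smul a t) T) : Q Γ T := by
  generalize e : Term.smul a t = u at ht
  induction ht with
  | smul P h1 h2 =>
    cases e
    exact h _ _ (Aff.mono (Set.image_mono h1) h2)
  | ax | lam | app | add => cases e
  | aff P _ h' ih => exact hQ.aff _ _ P (fun R hR => ih R hR e) h'
  | all_intro k _ h' ih => exact hQ.all_intro _ _ k (ih e) h'
  | all_elim A _ h' ih => exact hQ.all_elim _ _ _ A (ih e) h'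

end Typing

theorem stable_mem {Z : List (Ty S .unit) → AffSet S (Cls S)}
    (hi : ∀ Γ (T : Ty S .gen) k, T.cls ∈ Z (shiftCtx k Γ) → T.All (fun _ => True) →
      (T.mapU (.all k)).cls ∈ Z Γ)
    (he : ∀ Γ (T : Ty S .gen) k (A : Ty S k), T.cls ∈ Z Γ → T.All (IsAll k) →
      (T.mapU (instAll A)).cls ∈ Z Γ) :
    Stable fun Γ T => T.cls ∈ Z Γ where
  aff Γ T P h h' := (Z Γ).closed (Aff.mono (by rintro _ ⟨R, hR, rfl⟩; exact h R hR) h')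
  all_intro := hi
  all_elim := he

/-- Generation lemma for sums. -/
theorem typesOf_add (Γ : List (Ty S .unit)) (t r : Term S) :
    typesOf Γ (.add t r) = typesOf Γ t + typesOf Γ r := by
  ext g
  obtain ⟨T, rfl⟩ := exists_cls g
  rw [mem_typesOf]
  constructor
  · refine Typing.add_ind (Q := fun Γ T => T.cls ∈ typesOf Γ t + typesOf Γ r) (stable_mem ?_ ?_)
      fun Γ T R hT hR => AffSet.add_mem_add (mem_typesOf.2 hT) (mem_typesOf.2 hR)
    · rintro Γ T k ⟨_, ⟨T1, h1, rfl⟩, _, ⟨T2, h2, rfl⟩, e⟩ hT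
      have e' : Equiv T (.add T1 T2) := cls_eq.1 e.symm
      have hT' := e'.all_congr (fun _ _ _ => id) hT
      rw [cls_eq.2 (e'.mapU equiv_all)]
      exact AffSet.add_mem_add (mem_typesOf.2 (h1.all_intro k hT'.1))
        (mem_typesOf.2 (h2.all_intro k hT'.2))
    · rintro Γ T k A ⟨_, ⟨T1, h1, rfl⟩, _, ⟨T2, h2, rfl⟩, e⟩ hT
      have e' : Equiv T (.add T1 T2) := cls_eq.1 e.symm
      have hT' := e'.all_congr IsAll.congr hT
      rw [cls_eq.2 (e'.mapU (equiv_instAll A))]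
      exact AffSet.add_mem_add (mem_typesOf.2 (h1.all_elim A hT'.1))
        (mem_typesOf.2 (h2.all_elim A hT'.2))
  · rintro ⟨_, ⟨T1, h1, rfl⟩, _, ⟨T2, h2, rfl⟩, e⟩
    exact (h1.add h2).equiv (cls_eq.1 e)

/-- Generation lemma for scalar multiples. -/
theorem typesOf_smul (Γ : List (Ty S .unit)) (a : S) (t : Term S) :
    typesOf Γ (.smul a t) = a • typesOf Γ t := by
  ext g
  obtain ⟨T, rfl⟩ := exists_cls g
  rw [mem_typesOf]
  constructor
  · refine Typing.smul_ind (Q := fun Γ T => T.cls ∈ a • typesOf Γ t) (stable_mem ?_ ?_)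
      fun Γ T hT => hT
    · intro Γ T k h hT
      exact aff_mapU (fun _ _ _ => id) equiv_all
        (fun R hR h' => mem_typesOf.2 ((mem_typesOf.1 hR).all_intro k h')) h hT
    · intro Γ T k A h hT
      exact aff_mapU IsAll.congr (equiv_instAll A)
        (fun R hR h' => mem_typesOf.2 ((mem_typesOf.1 hR).all_elim A h')) h hT
  · exact fun h => .smul _ (fun _ h => h) h

theorem typesOf_app_le {Γ : List (Ty S .unit)} {t r : Term S} {T R : Ty S .gen}
    (hT : Typing Γ t T) (hR : Typing Γ r R) : appTy T R ≤ typesOf Γ (.app t r) := by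
  intro g hg
  obtain ⟨Q, rfl⟩ := exists_cls g
  exact mem_typesOf.2 (hT.app hR hg)

/-- Affine combinations create no new summands, so stability reduces to quantifier steps on one unit
type. -/
theorem stable_all {p : List (Ty S .unit) → Ty S .unit → Prop}
    (hp : ∀ Γ (U V : Ty S .unit), Equiv (.ofUnit U) (.ofUnit V) → p Γ U → p Γ V)
    (hi : ∀ Γ k U, p (shiftCtx k Γ) U → p Γ (.all k U))
    (he : ∀ Γ k (A : Ty S k) U, p Γ (.all k U) → p Γ (U.inst A)) :
    Stable fun Γ T => T.All (p Γ) where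
  aff Γ T P h h' := aff_all (hp Γ) h h'
  all_intro Γ T k h _ := All.mapU (hi Γ k) h
  all_elim Γ T k A h h' := by
    refine All.mapU (P := fun U => p Γ U ∧ IsAll k U) ?_ ?_
    · rintro _ ⟨hU, ⟨U⟩⟩
      rw [instAll_all]
      exact he Γ k A U hU
    · clear hp hi he
      induction T using gen_induction with
      | var n => exact h
      | ofUnit U => exact ⟨h, h'⟩
      | smul a T ih => exact ih h h'
      | add T R ih ih' => exact ⟨ih h.1 h'.1, ih' h.2 h'.2⟩

/-! ### Weights -/

/-- Mixing types of equal weight `w` with total coefficient `a` gives weight `a * w`, and quantifier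
rules act inside summands, all of weight 1. -/
theorem Typing.weight {Γ : List (Ty S .unit)} {t : Term S} {T : Ty S .gen} (h : Typing Γ t T)
    {w : S} (hw : t.weight = some w) : T.weight = some w := by
  induction h generalizing w with
  | ax => exact hw
  | lam => exact hw
  | app => cases hw
  | add _ _ ih ih' =>
    obtain ⟨w1, w2, h1, h2, rfl⟩ := Option.map₂_eq_some_iff.1 hw
    rw [Ty.weight, ih h1, ih' h2]
    rfl
  | smul P _ h' ih =>
    obtain ⟨w', hw', rfl⟩ := Option.map_eq_some_iff.1 hw
    exact aff_weight (fun R hR => ih R hR hw') h'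
  | aff P _ h' ih =>
    rw [aff_weight (fun R hR => ih R hR hw) h', one_mul]
  | all_intro k _ _ ih => rw [weight_mapU, ih hw]
  | all_elim A _ _ ih => rw [weight_mapU, ih hw]

/-! ### Substitution lemmas -/

theorem Equiv.rename {T R : Ty S .gen} (h : Equiv T R) (ρ : TyRen) :
    Equiv (T.rename ρ) (R.rename ρ) := by
  rw [rename_eq_subst, rename_eq_subst]
  exact h.subst _

namespace Typing

theorem subst_ty {Γ : List (Ty S .unit)} {t : Term S} {T : Ty S .gen} (h : Typing Γ t T)
    (σ : TySub S) : Typing (Γ.map (Ty.subst σ)) t (T.subst σ) := by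
  induction h generalizing σ with
  | ax h => exact .ax (by rw [List.getElem?_map, h]; rfl)
  | lam _ ih => exact .lam (ih σ)
  | app _ _ h ih ih' => exact .app (ih σ) (ih' σ) (subst_mem_appTy σ h)
  | add _ _ ih ih' => exact .add (ih σ) (ih' σ)
  | smul P _ h ih =>
    rw [← mem_typesOf, typesOf_smul]
    refine aff_subst σ ?_ h
    rintro _ ⟨R, hR, e⟩
    rw [← cls_eq.2 ((cls_eq.1 e).subst σ)]
    exact mem_typesOf.2 (ih R hR σ)
  | aff P _ h ih =>
    rw [← mem_typesOf]
    refine (typesOf _ _).closed (aff_subst σ ?_ h)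
    rintro _ ⟨R, hR, e⟩
    rw [← cls_eq.2 ((cls_eq.1 e).subst σ)]
    exact mem_typesOf.2 (ih R hR σ)
  | all_intro k _ h ih =>
    rw [mapU_subst (g := .all k) (τ := σ.lift k) (fun U _ => rfl) h]
    refine .all_intro k ?_ (h.subst fun _ _ => trivial)
    rw [← shiftCtx_subst_lift]
    exact ih _
  | @all_elim _ _ _ k A _ h ih =>
    rw [mapU_subst (g := instAll (A.subst σ)) (τ := σ) ?_ h]
    · refine .all_elim _ (ih σ) (h.subst ?_)
      rintro _ ⟨U⟩
      exact .mk _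
    · rintro _ ⟨U⟩
      rw [instAll_all, subst_inst]
      exact (instAll_all _ _).symm

/-- Context types may also change up to equivalence; `Canon.equiv` uses this, with the identity
renaming, for the domain of an arrow. -/
theorem rename {Γ : List (Ty S .unit)} {t : Term S} {T : Ty S .gen} (h : Typing Γ t T)
    {Δ : List (Ty S .unit)} {ρ : ℕ → ℕ}
    (hρ : ∀ n U, Γ[n]? = some U → ∃ V, Δ[ρ n]? = some V ∧ Equiv (.ofUnit V) (.ofUnit U)) :
    Typing Δ (t.rename ρ) T := by
  induction h generalizing Δ ρ with
  | ax h =>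
    obtain ⟨V, hV, e⟩ := hρ _ _ h
    exact (Typing.ax hV).equiv e
  | lam _ ih =>
    refine .lam (ih ?_)
    rintro (_ | n) U h
    · exact ⟨U, h, .refl _⟩
    · exact hρ n U h
  | app _ _ h ih ih' => exact .app (ih hρ) (ih' hρ) h
  | add _ _ ih ih' => exact .add (ih hρ) (ih' hρ)
  | smul P _ h ih => exact .smul P (fun R hR => ih R hR hρ) h
  | aff P _ h ih => exact .aff P (fun R hR => ih R hR hρ) h
  | all_intro k _ h ih =>
    refine .all_intro k (ih ?_) h
    intro n U hU
    rw [List.getElem?_map] at hU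
    obtain ⟨U', hU', rfl⟩ := Option.map_eq_some_iff.1 hU
    obtain ⟨V, hV, e⟩ := hρ n U' hU'
    exact ⟨_, by rw [List.getElem?_map, hV]; rfl, Equiv.rename e _⟩
  | all_elim A _ h ih => exact .all_elim A (ih hρ) h

theorem subst {Γ : List (Ty S .unit)} {t : Term S} {T : Ty S .gen} (h : Typing Γ t T)
    {Δ : List (Ty S .unit)} {σ : ℕ → Term S}
    (hσ : ∀ n U, Γ[n]? = some U → Typing Δ (σ n) (.ofUnit U)) :
    Typing Δ (t.subst σ) T := by
  induction h generalizing Δ σ with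
  | ax h => exact hσ _ _ h
  | lam _ ih =>
    refine .lam (ih ?_)
    rintro (_ | n) U h
    · exact .ax h
    · exact (hσ n U h).rename fun n U hU => ⟨U, hU, .refl _⟩
  | app _ _ h ih ih' => exact .app (ih hσ) (ih' hσ) h
  | add _ _ ih ih' => exact .add (ih hσ) (ih' hσ)
  | smul P _ h ih => exact .smul P (fun R hR => ih R hR hσ) h
  | aff P _ h ih => exact .aff P (fun R hR => ih R hR hσ) h
  | all_intro k _ h ih =>
    refine .all_intro k (ih ?_) h
    intro n U hU
    rw [List.getElem?_map] at hU
    obtain ⟨U', hU', rfl⟩ := Option.map_eq_some_iff.1 hU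
    -- Weakening by a fresh type variable is a type substitution applied to the derivation.
    have := (hσ n U' hU').subst_ty fun l n => .var l (TyRen.shift k l n)
    rw [← rename_eq_subst] at this
    have e : shiftCtx k Δ = Δ.map (Ty.subst fun l n => .var l (TyRen.shift k l n)) :=
      List.map_congr_left fun U _ => rename_eq_subst U _
    rw [e]
    exact this
  | all_elim A _ h ih => exact .all_elim A (ih hσ) h

theorem inst {Γ : List (Ty S .unit)} {t b : Term S} {U : Ty S .unit} {T : Ty S .gen}
    (h : Typing (U :: Γ) t T) (hb : Typing Γ b (.ofUnit U)) : Typing Γ (t.inst b) T := by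
  refine h.subst ?_
  rintro (_ | n) V hV
  · cases hV
    exact hb
  · exact .ax hV

end Typing

/-! ### Generation lemmas for basis terms -/

/-- `Canon t Γ V`: the type `V` of `λt` is obtained by introduction rules only. -/
inductive Canon (t : Term S) : List (Ty S .unit) → Ty S .unit → Prop
  | arr {Γ : List (Ty S .unit)} {U : Ty S .unit} {T : Ty S .gen} :
      Typing (U :: Γ) t T → Canon t Γ (.arr U T)
  | all {Γ : List (Ty S .unit)} {U : Ty S .unit} (k : Kind) :
      Canon t (shiftCtx k Γ) U → Canon t Γ (.all k U)

namespace Canon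

variable {t : Term S} {Γ : List (Ty S .unit)} {U V : Ty S .unit}

theorem equiv (h : Canon t Γ U) (e : Equiv (.ofUnit U) (.ofUnit V)) : Canon t Γ V := by
  induction h generalizing V with
  | arr h =>
    cases e.shape with
    | arr e1 e2 =>
      refine .arr ?_
      rw [← t.rename_id]
      refine (h.equiv e2).rename ?_
      rintro (_ | n) U' hU
      · cases hU
        exact ⟨_, rfl, e1.symm⟩
      · exact ⟨_, hU, .refl _⟩
  | all k _ ih =>
    cases e.shape with
    | all _ e' => exact .all k (ih e')

theorem subst (h : Canon t Γ U) (σ : TySub S) :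
    Canon t (Γ.map (Ty.subst σ)) (U.subst σ) := by
  induction h generalizing σ with
  | arr h => exact .arr (h.subst_ty σ)
  | all k _ ih =>
    refine .all k ?_
    rw [← shiftCtx_subst_lift]
    exact ih _

/-- Removes a detour: the quantified variable is fresh for `Γ`, so substituting for it in the
derivation leaves `Γ` intact. -/
theorem inst {k : Kind} (h : Canon t Γ (.all k U)) (A : Ty S k) : Canon t Γ (U.inst A) := by
  cases h with
  | all _ h =>
    have := h.subst (TySub.push ⟨k, A⟩ fun k n => .var k n)
    rwa [shiftCtx_inst] at this

theorem of_inst (h : Canon t Γ U) (hi : Inst U V) : Canon t Γ V := by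
  induction hi with
  | of e => exact h.equiv e
  | step A e _ ih => exact ih ((h.equiv e).inst A)

end Canon

theorem Typing.canon {Γ : List (Ty S .unit)} {t : Term S} {T : Ty S .gen}
    (h : Typing Γ (.lam t) T) : T.All (Canon t Γ) :=
  Typing.lam_ind (Q := fun Γ T => T.All (Canon t Γ))
    (stable_all (fun _ _ _ e h => h.equiv e) (fun _ k _ h => h.all k) fun _ _ A _ h => h.inst A)
    (fun _ _ _ h => .arr h) h

theorem stable_all_typing (b : Term S) :
    Stable fun Γ T => T.All fun U => Typing Γ b (.ofUnit U) :=
  stable_all (fun _ _ _ e h => h.equiv e) (fun _ k _ h => h.all_intro k trivial) fun _ k A U h => by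
    have := h.all_elim A (IsAll.mk U)
    rwa [Ty.mapU, instAll_all] at this

/-- The syntax-directed rule for a basis term yields one unit type, and the other rules keep each
summand a type of the term. -/
theorem Typing.all_of_isBasis {Γ : List (Ty S .unit)} {b : Term S} {T : Ty S .gen}
    (hb : b.IsBasis) (h : Typing Γ b T) : T.All fun U => Typing Γ b (.ofUnit U) := by
  cases hb with
  | var n =>
    refine Typing.var_ind (stable_all_typing (.var n)) (fun Γ U h => ?_) h
    change Typing Γ (.var n) (.ofUnit U)
    exact .ax h
  | lam t =>
    refine Typing.lam_ind (stable_all_typing (.lam t)) (fun Γ U T h => ?_) h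
    change Typing Γ (.lam t) (.ofUnit (.arr U T))
    exact .lam h

theorem Term.IsBasis.weight {b : Term S} (hb : b.IsBasis) : b.weight = some 1 := by
  cases hb <;> rfl

/-! ### Subject reduction -/

theorem Typing.beta {Γ : List (Ty S .unit)} {t b : Term S} {T : Ty S .gen} (hb : b.IsBasis)
    (h : Typing Γ (.app (.lam t) b) T) : Typing Γ (t.inst b) T := by
  refine Typing.app_ind (stable_typing _) ?_ h
  intro Γ T R Q hT hR hQ
  rw [← mem_typesOf]
  rw [← one_smul S (typesOf Γ (t.inst b))]
  -- An abstraction has weight 1, so the outer combination is affine; the same holds below for the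
  -- basis argument.
  refine ext_le_smul ?_ (hT.weight rfl) hQ
  refine hT.canon.mono fun V hV => ?_
  rw [← one_smul S (typesOf Γ (t.inst b))]
  refine ext_le_smul ?_ (hR.weight hb.weight)
  refine (hR.all_of_isBasis hb).mono fun U hU => AffSet.span_le ?_
  rintro _ ⟨T, hi, rfl⟩
  cases hV.of_inst hi with
  | arr h => exact mem_typesOf.2 (h.inst hU)

/-- All contexts are needed, because the application may be typed in a shifted context before
quantifiers are introduced. -/
theorem typesOf_app_mono {Γ : List (Ty S .unit)} {t t' r r' : Term S}
    (h : ∀ Γ, typesOf Γ t ≤ typesOf Γ t') (h' : ∀ Γ, typesOf Γ r ≤ typesOf Γ r') :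
    typesOf Γ (.app t r) ≤ typesOf Γ (.app t' r') := by
  rintro _ ⟨T, hT, rfl⟩
  refine mem_typesOf.2 (Typing.app_ind (stable_typing _) (fun Γ T R Q hT hR hQ => ?_) hT)
  exact .app (mem_typesOf.1 (h Γ (mem_typesOf.2 hT))) (mem_typesOf.1 (h' Γ (mem_typesOf.2 hR))) hQ

theorem typesOf_lam_mono {Γ : List (Ty S .unit)} {t t' : Term S}
    (h : ∀ Γ, typesOf Γ t ≤ typesOf Γ t') : typesOf Γ (.lam t) ≤ typesOf Γ (.lam t') := by
  rintro _ ⟨T, hT, rfl⟩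
  refine mem_typesOf.2 (Typing.lam_ind (stable_typing _) (fun Γ U T hT => ?_) hT)
  exact .lam (mem_typesOf.1 (h _ (mem_typesOf.2 hT)))

theorem typesOf_le_of_app {t r u : Term S}
    (h : ∀ Γ T R, Typing Γ t T → Typing Γ r R → appTy T R ≤ typesOf Γ u)
    (Γ : List (Ty S .unit)) : typesOf Γ (.app t r) ≤ typesOf Γ u := by
  rintro _ ⟨T, hT, rfl⟩
  exact mem_typesOf.2 (Typing.app_ind (stable_typing _)
    (fun Γ T R Q hT hR hQ => mem_typesOf.1 (h Γ T R hT hR hQ)) hT)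

theorem Term.AC.typesOf_eq {t r : Term S} (h : Term.AC t r) (Γ : List (Ty S .unit)) :
    typesOf Γ t = typesOf Γ r := by
  induction h generalizing Γ with
  | comm t r => rw [typesOf_add, typesOf_add, add_comm]
  | assoc t r s => simp only [typesOf_add, add_assoc]
  | refl => rfl
  | symm _ ih => exact (ih Γ).symm
  | trans _ _ ih ih' => exact (ih Γ).trans (ih' Γ)
  | lam _ ih =>
    ext g
    exact ⟨fun h => typesOf_lam_mono (fun Γ g => (ih Γ ▸ ·)) h,
      fun h => typesOf_lam_mono (fun Γ g => (ih Γ ▸ ·)) h⟩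
  | app _ _ ih ih' =>
    ext g
    exact ⟨fun h => typesOf_app_mono (fun Γ g => (ih Γ ▸ ·)) (fun Γ g => (ih' Γ ▸ ·)) h,
      fun h => typesOf_app_mono (fun Γ g => (ih Γ ▸ ·)) (fun Γ g => (ih' Γ ▸ ·)) h⟩
  | smul a _ ih => rw [typesOf_smul, typesOf_smul, ih]
  | add _ _ ih ih' => rw [typesOf_add, typesOf_add, ih, ih']

theorem AffSet.le_rfl {G : Type*} [AddCommSemigroup G] [WeakModule S G] {X : AffSet S G} :
    X ≤ X := fun _ => id

/-- Subject reduction: the module rules are identities of affine sets, and the application rules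
come from bilinearity of `appTy`. -/
theorem Term.Red.typesOf_le {t r : Term S} (h : Term.Red t r) (Γ : List (Ty S .unit)) :
    typesOf Γ t ≤ typesOf Γ r := by
  induction h generalizing Γ with
  | one_smul t => rw [typesOf_smul, _root_.one_smul]; exact AffSet.le_rfl
  | smul_smul a b t => simp only [typesOf_smul, _root_.smul_smul]; exact AffSet.le_rfl
  | smul_add a t r => simp only [typesOf_smul, typesOf_add, smul_add']; exact AffSet.le_rfl
  | fact a b t => simp only [typesOf_smul, typesOf_add, add_smul']; exact AffSet.le_rfl
  | fact_one a t =>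
    simp only [typesOf_smul, typesOf_add, add_smul', _root_.one_smul]; exact AffSet.le_rfl
  | fact_one_one t =>
    simp only [typesOf_smul, typesOf_add, add_smul', _root_.one_smul]; exact AffSet.le_rfl
  | add_app t r s =>
    refine typesOf_le_of_app (fun Γ T R hT hR => ?_) Γ
    rw [← mem_typesOf, typesOf_add] at hT
    obtain ⟨_, ⟨T1, h1, rfl⟩, _, ⟨T2, h2, rfl⟩, e⟩ := hT
    rw [appTy_congr (Equiv.of_cls_add e.symm) (.refl R), appTy_add_left, typesOf_add]
    exact AffSet.add_mono (typesOf_app_le h1 hR) (typesOf_app_le h2 hR)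
  | app_add t r s =>
    refine typesOf_le_of_app (fun Γ T R hT hR => ?_) Γ
    rw [← mem_typesOf, typesOf_add] at hR
    obtain ⟨_, ⟨R1, h1, rfl⟩, _, ⟨R2, h2, rfl⟩, e⟩ := hR
    rw [appTy_congr (.refl T) (Equiv.of_cls_add e.symm), appTy_add_right, typesOf_add]
    exact AffSet.add_mono (typesOf_app_le hT h1) (typesOf_app_le hT h2)
  | smul_app a t r =>
    refine typesOf_le_of_app (fun Γ T R hT hR => ?_) Γ
    rw [← mem_typesOf, typesOf_smul] at hT
    rw [typesOf_smul]
    exact appTy_le_of_aff_left (fun T hT => typesOf_app_le (mem_typesOf.1 hT) hR) hT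
  | app_smul a t r =>
    refine typesOf_le_of_app (fun Γ T R hT hR => ?_) Γ
    rw [← mem_typesOf, typesOf_smul] at hR
    rw [typesOf_smul]
    exact appTy_le_of_aff_right (fun R hR => typesOf_app_le hT (mem_typesOf.1 hR)) hR
  | beta t b hb =>
    rintro _ ⟨T, hT, rfl⟩
    exact mem_typesOf.2 (Typing.beta hb hT)
  | ctx_smul a _ ih => rw [typesOf_smul, typesOf_smul]; exact AffSet.smul_mono a (ih Γ)
  | ctx_add s _ ih =>
    rw [typesOf_add, typesOf_add]; exact AffSet.add_mono AffSet.le_rfl (ih Γ)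
  | ctx_app_right s _ ih => exact typesOf_app_mono (fun _ => AffSet.le_rfl) ih
  | ctx_app_left s _ ih => exact typesOf_app_mono ih fun _ => AffSet.le_rfl
  | ctx_lam _ ih => exact typesOf_lam_mono ih

theorem Term.Reduces.typing {Γ : List (Ty S .unit)} {t r : Term S} {T : Ty S .gen}
    (h : Term.Reduces t r) (ht : Typing Γ t T) : Typing Γ r T := by
  induction h with
  | refl => exact ht
  | tail _ h ih =>
    obtain ⟨t', r', h1, h2, h3⟩ := h
    rw [← mem_typesOf, h1.typesOf_eq] at ih
    rw [← mem_typesOf, ← h3.typesOf_eq]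
    exact h2.typesOf_le Γ ih

/-! ### Translation of typing derivations -/

namespace Ty

theorem aff_lin {X : Set (Cls S)} {n : ℕ} {a : Fin (n + 1) → S} {T : Fin (n + 1) → Ty S .gen}
    (h : ∀ i, (T i).cls ∈ X) : Aff X (∑ i, a i) (Ty.lin a T).cls := by
  induction n with
  | zero =>
    rw [Fin.sum_univ_one]
    exact Aff.smul_of _ (h 0)
  | succ n ih =>
    rw [Fin.sum_univ_castSucc]
    exact (ih fun i => h _).add (Aff.smul_of _ (h _))

theorem smul_sum (a : S) {n : ℕ} (f : Fin (n + 1) → Ty S .gen) :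
    a • (Ty.sum f).cls = (Ty.sum fun i => .smul a (f i)).cls := by
  induction n with
  | zero => rfl
  | succ n ih =>
    rw [Ty.sum, cls_add, smul_add', ih, Ty.sum, cls_add]
    rfl

theorem cls_sum_congr {n : ℕ} {f g : Fin (n + 1) → Ty S .gen} (h : ∀ i, (f i).cls = (g i).cls) :
    (Ty.sum f).cls = (Ty.sum g).cls := by
  induction n with
  | zero => exact h 0
  | succ n ih => rw [Ty.sum, cls_add, ih fun i => h _, h, Ty.sum, cls_add]

theorem smul_lin (a : S) {n : ℕ} (b : Fin (n + 1) → S) (T : Fin (n + 1) → Ty S .gen) :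
    a • (Ty.lin b T).cls = (Ty.lin (fun i => a * b i) T).cls := by
  rw [Ty.lin, smul_sum]
  exact cls_sum_congr fun i => smul_smul a (b i) (T i).cls

theorem sum_mem_ext {F : Ty S .unit → AffSet S (Cls S)} {v : ℕ → AffSet S (Cls S)} {n : ℕ}
    {f g : Fin (n + 1) → Ty S .gen} (h : ∀ i, (g i).cls ∈ (f i).ext F v) :
    (Ty.sum g).cls ∈ (Ty.sum f).ext F v := by
  induction n with
  | zero => exact h 0
  | succ n ih => exact AffSet.add_mem_add (ih fun i => h _) (h _)

theorem lin_mem_ext {F : Ty S .unit → AffSet S (Cls S)} {v : ℕ → AffSet S (Cls S)} {n : ℕ}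
    (a : Fin (n + 1) → S) {f g : Fin (n + 1) → Ty S .gen} (h : ∀ i, (g i).cls ∈ (f i).ext F v) :
    (Ty.lin a g).cls ∈ (Ty.lin a f).ext F v :=
  sum_mem_ext fun i => AffSet.smul_mem_smul (a i) (h i)

end Ty

theorem HasType.typing {Γ : List (Ty S .unit)} {t : Term S} {T : Ty S .gen}
    (h : HasType Γ t T) : Typing Γ t T := by
  induction h with
  | ax h => exact .ax h
  | equiv _ e ih => exact ih.equiv e.symm
  | arr_intro _ ih => exact .lam ih
  | arr_elim ks U a T b A hA _ _ ih ih' =>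
    refine .app ih ih' (sum_mem_ext fun i => ?_)
    rw [← smul_lin]
    refine AffSet.smul_mem_smul (a i) (lin_mem_ext b fun j => ?_)
    -- The application rule picks a single point of the affine hull for each pair `(i, j)`.
    refine AffSet.mem_span ⟨_, ?_, rfl⟩
    have := inst_allN ks (.arr U (T i)) (fun k n => .var k n) (A j) (hA j)
    rwa [subst_var] at this
  | all_intro k a U _ ih =>
    have := ih.all_intro k (sum_all fun i => trivial)
    rwa [Ty.lin, sum_mapU] at this
  | all_elim k A a U _ ih =>
    have := ih.all_elim A (sum_all fun i => IsAll.mk (U i))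
    rw [Ty.lin, sum_mapU] at this
    simp only [Ty.mapU, instAll_all] at this
    exact this
  | add_intro _ _ ih ih' => exact .add ih ih'
  -- Here affine closure enters, as `1 • X = X`.
  | one_elim _ ih => rwa [← mem_typesOf, typesOf_smul, one_smul, mem_typesOf] at ih
  | smul_intro a T _ ih =>
    rw [← mem_typesOf, typesOf_smul]
    exact aff_lin fun i => mem_typesOf.2 (ih i)

/-! ### Weights of values -/

theorem Term.AC.weight_eq {t r : Term S} (h : Term.AC t r) : t.weight = r.weight := by
  induction h with
  | comm t r =>
    cases h : t.weight <;> cases h' : r.weight <;> simp [Term.weight, h, h', _root_.add_comm]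
  | assoc t r s =>
    cases h : t.weight <;> cases h' : r.weight <;> cases h'' : s.weight <;>
      simp [Term.weight, h, h', h'', _root_.add_assoc]
  | refl => rfl
  | symm _ ih => exact ih.symm
  | trans _ _ ih ih' => exact ih.trans ih'
  | lam => rfl
  | app => rfl
  | smul a _ ih => rw [Term.weight, ih, Term.weight]
  | add _ _ ih ih' => rw [Term.weight, ih, ih', Term.weight]

theorem Term.exists_weight_foldl {s : Term S} {l : List (Term S)} (hs : ∃ w, s.weight = some w)
    (hl : ∀ t ∈ l, ∃ w, t.weight = some w) : ∃ w, (l.foldl Term.add s).weight = some w := by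
  induction l generalizing s with
  | nil => exact hs
  | cons t l ih =>
    refine ih ?_ fun t ht => hl t (List.mem_cons_of_mem _ ht)
    obtain ⟨w, hw⟩ := hs
    obtain ⟨w', hw'⟩ := hl t List.mem_cons_self
    exact ⟨w + w', by rw [Term.weight, hw, hw']; rfl⟩

theorem Term.IsValue.exists_weight {v : Term S} (hv : v.IsValue) : ∃ w, v.weight = some w := by
  obtain ⟨L, M, s, l, -, e, hAC⟩ := hv
  have h : ∀ t ∈ s :: l, ∃ w, t.weight = some w := by
    intro t ht
    rw [← e, List.mem_append, List.mem_map, List.mem_map] at ht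
    obtain ⟨p, -, rfl⟩ | ⟨q, -, rfl⟩ := ht
    · exact ⟨p.1 * 1, rfl⟩
    · exact ⟨1, rfl⟩
  rw [hAC.weight_eq]
  exact exists_weight_foldl (h s List.mem_cons_self) fun t ht => h t (List.mem_cons_of_mem _ ht)

end VecLambda

theorem mainTheorem4 {S : Type*} [CommRing S] (t v : VecLambda.Term S)
    (T : VecLambda.Ty S VecLambda.Kind.gen) (ht : VecLambda.HasType [] t T)
    (hred : VecLambda.Term.Reduces t v) (hv : VecLambda.Term.IsValue v) :
    ∃ w : S, VecLambda.Ty.weight T = some w ∧ VecLambda.Term.weight v = some w := by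
  obtain ⟨w, hw⟩ := hv.exists_weight
  exact ⟨w, (hred.typing ht.typing).weight hw, hw⟩
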